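/- Let $\mathrm{Ai}$ be the Airy function, $\mathrm{Ai}(x)=\frac1\pi\lim_{T\to\infty}\int_0^T\cos\left(\frac{s^3}{3}+xs\right)ds$ for $x\in\mathbb{R}$. Let $a\in\mathbb{R}$, and let $\varphi:\mathbb{R}\to\mathbb{R}$ be piecewise continuously differentiable, that is, continuously differentiable except at exceptional points of which every bounded interval contains only finitely many, and at each of which both $\varphi$ and $\varphi'$ have finite one-sided limits from the left and from the right. Suppose that the integrals $$\int_{-\infty}^{-1}|x|^{-3/4}|\varphi(x)|\,dx\qquad\text{and}\qquad\int_{1}^{\infty}x^{-3/4}|\varphi(x)|\,dx$$ are finite. Then, for every $R\in\mathbb{R}$, the integral $\int_{-R}^{\infty}\mathrm{Ai}(t-x)\,\mathrm{Ai}(t-a)\,dt$ converges absolutely for every $x\in\mathbb{R}$, the integral $\int_{-\infty}^{\infty}\varphi(x)\int_{-R}^{\infty}\mathrm{Ai}(t-x)\,\mathrm{Ai}(t-a)\,dt\,dx$ converges absolutely as an integral in $x$, and $$\lim_{R\to\infty}\int_{-\infty}^{\infty}\varphi(x)\int_{-R}^{\infty}\mathrm{Ai}(t-x)\,\mathrm{Ai}(t-a)\,dt\,dx=\tfrac12\left[\varphi(a^-)+\varphi(a^+)\right],$$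 where $\varphi(a^-)$ and $\varphi(a^+)$ are the one-sided limits of $\varphi$ at $a$, which exist. -/

import Mathlib

open Set Filter Topology MeasureTheory

/-- The Airy function of a real variable, as the improper integral
`Ai(x) = (1/π) lim_{T → ∞} ∫_0^T cos(s³/3 + x s) ds`. -/
noncomputable def airyAi (x : ℝ) : ℝ :=
  limUnder atTop (fun T : ℝ => (1 / Real.pi) * ∫ s in (0 : ℝ)..T, Real.cos (s ^ 3 / 3 + x * s))

/-- `φ` is piecewise continuously differentiable on `ℝ`: there is a set `S` of exceptional points,
finitely many in every bounded interval, such that `φ` is continuously differentiable off `S`, and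
at every point of `S` both `φ` and its derivative have finite one-sided limits from either side.
The values of `φ` at the points of `S` are arbitrary. -/
def IsPiecewiseC1 (φ : ℝ → ℝ) : Prop :=
  ∃ S : Set ℝ,
    (∀ A B : ℝ, (S ∩ Icc A B).Finite) ∧
    (∀ x ∉ S, DifferentiableAt ℝ φ x ∧ ContinuousAt (deriv φ) x) ∧
    (∀ s ∈ S,
      (∃ l : ℝ, Tendsto φ (𝓝[<] s) (𝓝 l)) ∧
      (∃ r : ℝ, Tendsto φ (𝓝[>] s) (𝓝 r)) ∧
      (∃ l' : ℝ, Tendsto (deriv φ) (𝓝[<] s) (𝓝 l')) ∧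
      (∃ r' : ℝ, Tendsto (deriv φ) (𝓝[>] s) (𝓝 r')))

/-! Write `x = a + s` and `b = R + a`. By Airy's equation the inner integrand, multiplied by `x -
a`, is an exact derivative in `t`, so the inner integral equals `f(s) / s`, where `f = airyKernelNum
b` is a Wronskian-like expression in `Ai` and `Ai'` at `-(b + s)` and `-b`
(`sub_mul_integral_airyAi_mul_airyAi`). The theorem is then proved like Dirichlet's theorem for
Fourier integrals, with `f(s) / s` in place of `sin (√b s) / (π s)`.

Subtract from `φ(a + s)` the step function equal to the one-sided limits of `φ` at `a` on either
side of `0` and vanishing outside a unit neighbourhood. The remainder divided by `s` is bounded near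
`0`, because the one-sided limits of `φ'` are finite. Its integral against `f` tends to `0` by a
Riemann–Lebesgue argument (`tendsto_integral_mul_airyKernelNum`): `f'' = -(b + s) f + O(1)`, so two
integrations by parts against a smooth test function gain a factor `1 / b`, and density does the
rest. Density needs a bound for `f` uniform in `b`. This is `|f(s)| ≤ C (1 + |s|)^{1/4}`, and
dividing by `s` gives exactly the weight `|x|^{-3/4}` of the hypotheses.

The step contributes half of each one-sided limit (`tendsto_integral_airyKernel`). For `|s| ≤ 1`,
variation of constants compares `f(s)` with `E(b) sin (√b s)`, where `E = airyAiEnergy`, and the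
Dirichlet integral gives `E(b) · π / 2` in the limit. So everything rests on `E(b) → 1 / π`
(`tendsto_airyAiEnergy`). No asymptotic expansion of `Ai` is used: `E` converges because a small
correction of it is monotone (`airyEnergy_tendsto`), which also bounds `Ai` and `Ai'`. The limit is
then identified by computing the Laplace transform of `Ai(-y)²` exactly through Plancherel and
comparing its behaviour as `p → 0` with an Abelian theorem. -/

/-! ### Contour representation, Airy's equation and exponential decay. -/

open Complex in
/-- The integrand `exp (i (z³/3 + x z))` of the contour representation of the Airy function. -/
noncomputable def airyExp (x : ℝ) (z : ℂ) : ℂ := cexp (I * (z ^ 3 / 3 + x * z))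

open Complex in
lemma norm_airyExp (x s η : ℝ) :
    ‖airyExp x (s + η * I)‖ = Real.exp (-η * s ^ 2) * Real.exp (η ^ 3 / 3 - x * η) := by
  rw [airyExp, Complex.norm_exp, ← Real.exp_add]
  congr 1
  have : I * (((s : ℂ) + η * I) ^ 3 / 3 + x * (s + η * I)) =
      ((-η * s ^ 2 + (η ^ 3 / 3 - x * η) : ℝ) : ℂ) +
        ((s ^ 3 / 3 - s * η ^ 2 + x * s : ℝ) : ℂ) * I := by
    push_cast
    have h2 : I ^ 2 = -1 := I_sq
    have h4 : I ^ 4 = 1 := by rw [show (4 : ℕ) = 2 * 2 from rfl, pow_mul, h2]; norm_num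
    ring_nf
    rw [show I ^ 3 = I ^ 2 * I by ring, h2, h4]
    ring
  rw [this, add_re, ofReal_re, re_ofReal_mul, I_re]
  ring

open Complex in
lemma differentiable_airyExp (x : ℝ) : Differentiable ℂ (airyExp x) := by
  unfold airyExp; fun_prop

open Complex in
lemma airyExp_ofReal (x s : ℝ) :
    airyExp x s = (Real.cos (s ^ 3 / 3 + x * s) : ℂ) + (Real.sin (s ^ 3 / 3 + x * s) : ℂ) * I := by
  rw [airyExp, mul_comm, Complex.ofReal_cos, Complex.ofReal_sin, ← Complex.exp_mul_I]
  push_cast; rfl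

/-- The moments `∫ (i z)^k exp (i (z³/3 + x z)) dz` along the line `Im z = η`. -/
noncomputable def airyMoment (k : ℕ) (η x : ℝ) : ℂ :=
  ∫ s : ℝ, (Complex.I * (s + η * Complex.I)) ^ k * airyExp x (s + η * Complex.I)

lemma integrable_airyMajorant {η : ℝ} (hη : 0 < η) (c : ℝ) :
    Integrable (fun s : ℝ => (1 + η ^ 2 + s ^ 2) * Real.exp (-η * s ^ 2) * c) := by
  have h1 := (integrable_exp_neg_mul_sq hη).const_mul (1 + η ^ 2)
  have h2 := integrable_rpow_mul_exp_neg_mul_sq hη (s := 2) (by norm_num)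
  refine ((h1.add h2).congr (Eventually.of_forall fun s => ?_)).mul_const c
  simp only [Pi.add_apply, Real.rpow_two]; ring

open Complex in
lemma norm_airyMoment_integrand_le {k : ℕ} (hk : k ≤ 2) (η x s : ℝ) :
    ‖(I * ((s : ℂ) + η * I)) ^ k * airyExp x (s + η * I)‖ ≤
      (1 + η ^ 2 + s ^ 2) * Real.exp (-η * s ^ 2) * Real.exp (η ^ 3 / 3 - x * η) := by
  rw [norm_mul, norm_airyExp, norm_pow, norm_mul, norm_I, one_mul, mul_assoc]
  refine mul_le_mul_of_nonneg_right ?_ (by positivity)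
  have h : ‖(s : ℂ) + η * I‖ ^ 2 = s ^ 2 + η ^ 2 := by
    rw [← normSq_eq_norm_sq, normSq_add_mul_I]
  have h0 := norm_nonneg ((s : ℂ) + η * I)
  interval_cases k
  · nlinarith
  · nlinarith [sq_nonneg (‖(s : ℂ) + η * I‖ - 1)]
  · nlinarith

open Complex in
lemma continuous_airyMoment_integrand (k : ℕ) (η x : ℝ) :
    Continuous (fun s : ℝ => (I * ((s : ℂ) + η * I)) ^ k * airyExp x (s + η * I)) := by
  unfold airyExp; fun_prop

open Complex in
lemma integrable_airyMoment_integrand {k : ℕ} (hk : k ≤ 2) {η : ℝ} (hη : 0 < η) (x : ℝ) :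
    Integrable (fun s : ℝ => (I * ((s : ℂ) + η * I)) ^ k * airyExp x (s + η * I)) :=
  (integrable_airyMajorant hη _).mono' (continuous_airyMoment_integrand k η x).aestronglyMeasurable
    (Eventually.of_forall fun s => norm_airyMoment_integrand_le hk η x s)

lemma norm_airyMoment_le {k : ℕ} (hk : k ≤ 2) {η : ℝ} (hη : 0 < η) :
    ∃ C, ∀ x, ‖airyMoment k η x‖ ≤ C * Real.exp (-(η * x)) := by
  refine ⟨∫ s : ℝ, (1 + η ^ 2 + s ^ 2) * Real.exp (-η * s ^ 2) * Real.exp (η ^ 3 / 3), fun x => ?_⟩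
  refine (norm_integral_le_of_norm_le (integrable_airyMajorant hη _)
    (Eventually.of_forall fun s => norm_airyMoment_integrand_le hk η x s)).trans_eq ?_
  rw [← integral_mul_const]
  congr 1; ext s
  rw [mul_assoc _ _ (Real.exp (-(η * x))), ← Real.exp_add]
  ring_nf

open Complex in
lemma hasDerivAt_airyMoment {k : ℕ} (hk : k ≤ 1) {η : ℝ} (hη : 0 < η) (x : ℝ) :
    HasDerivAt (airyMoment k η) (airyMoment (k + 1) η x) x := by
  refine (hasDerivAt_integral_of_dominated_loc_of_deriv_le (Metric.ball_mem_nhds x one_pos)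
    (F := fun (x s : ℝ) => (I * ((s : ℂ) + η * I)) ^ k * airyExp x (s + η * I))
    (F' := fun (x s : ℝ) => (I * ((s : ℂ) + η * I)) ^ (k + 1) * airyExp x (s + η * I))
    (Eventually.of_forall fun y => (continuous_airyMoment_integrand k η y).aestronglyMeasurable)
    (integrable_airyMoment_integrand (by omega) hη x)
    (continuous_airyMoment_integrand (k + 1) η x).aestronglyMeasurable
    (Eventually.of_forall fun s y hy => ?_)
    (integrable_airyMajorant hη (Real.exp (η ^ 3 / 3 - (x - 1) * η)))
    (Eventually.of_forall fun s y _ => ?_)).2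
  · refine (norm_airyMoment_integrand_le (by omega) η y s).trans ?_
    rw [Metric.mem_ball, Real.dist_eq, abs_lt] at hy
    gcongr
    linarith
  · have h1 : HasDerivAt (fun y : ℝ => I * (((s : ℂ) + η * I) ^ 3 / 3 + y * (s + η * I)))
        (I * ((s : ℂ) + η * I)) y := by
      have := (((hasDerivAt_id y).ofReal_comp.mul_const ((s : ℂ) + η * I)).const_add
        (((s : ℂ) + η * I) ^ 3 / 3)).const_mul I
      simpa using this
    have h2 := (h1.cexp).const_mul ((I * ((s : ℂ) + η * I)) ^ k)
    refine h2.congr_deriv ?_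
    simp only [airyExp]; ring

open Complex in
-- The integrand `exp (i (z³/3 + x z))` has `z`-derivative `i (z² + x)` times itself, and the
-- integral of that derivative over the whole line vanishes. Since `(i z)² = -z²`, this is Airy's
-- equation.
lemma airyMoment_two {η : ℝ} (hη : 0 < η) (x : ℝ) :
    airyMoment 2 η x = x * airyMoment 0 η x := by
  have h0 := integrable_airyMoment_integrand (k := 0) (by norm_num) hη x
  have h2 := integrable_airyMoment_integrand (k := 2) (by norm_num) hη x
  have hd : ∀ s : ℝ, HasDerivAt (fun s : ℝ => airyExp x (s + η * I))
      (I * (x * airyExp x (s + η * I)) - I * ((I * ((s : ℂ) + η * I)) ^ 2 *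
        airyExp x (s + η * I))) s := by
    intro s
    have hz : HasDerivAt (fun s : ℝ => (s : ℂ) + η * I) 1 s :=
      ((hasDerivAt_id s).ofReal_comp).add_const _
    have h1 := ((((hz.pow 3).div_const 3).add (hz.const_mul (x : ℂ))).const_mul I).cexp
    refine h1.congr_deriv ?_
    simp only [airyExp, Pi.add_apply, Pi.pow_apply, mul_pow, I_sq]
    push_cast
    ring
  have h := integral_eq_zero_of_hasDerivAt_of_integrable hd
    (((h0.const_mul (x : ℂ)).const_mul I).sub (h2.const_mul I) |>.congr
      (Eventually.of_forall fun s => by simp)) (h0.congr (Eventually.of_forall fun s => by simp))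
  rw [integral_sub, integral_const_mul, integral_const_mul, integral_const_mul, ← mul_sub,
    mul_eq_zero, or_iff_right I_ne_zero, sub_eq_zero] at h
  · unfold airyMoment; rw [← h]; simp
  · simpa using (h0.const_mul (x : ℂ)).const_mul I
  · exact h2.const_mul I

open Complex in
-- At height `v > 0` the integrand has the factor `exp (-v T²)`, so dominated convergence suffices.
-- A general filter covers both vertical sides of the rectangle, `T → ∞` and `T → -∞`.
lemma tendsto_airyExp_vertical (x : ℝ) {η : ℝ} (hη : 0 < η) (l : Filter ℝ) [l.IsCountablyGenerated]
    (hl : Tendsto (fun T : ℝ => T ^ 2) l atTop) :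
    Tendsto (fun T : ℝ => ∫ v in (0 : ℝ)..η, airyExp x (T + v * I)) l (𝓝 0) := by
  have := intervalIntegral.tendsto_integral_filter_of_dominated_convergence (μ := volume)
    (a := 0) (b := η) (l := l) (F := fun (T v : ℝ) => airyExp x (T + v * I)) (f := fun _ => 0)
    (fun v => Real.exp (v ^ 3 / 3 - x * v)) ?_ ?_ ?_ ?_
  · simpa using this
  · refine Eventually.of_forall fun T => Continuous.aestronglyMeasurable ?_
    unfold airyExp; fun_prop
  · refine Eventually.of_forall fun T => Eventually.of_forall fun v hv => ?_
    rw [norm_airyExp]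
    rw [uIoc_of_le hη.le] at hv
    refine mul_le_of_le_one_left (by positivity) (Real.exp_le_one_iff.2 ?_)
    nlinarith [hv.1, sq_nonneg T]
  · exact Continuous.intervalIntegrable (by fun_prop) _ _
  · refine Eventually.of_forall fun v hv => ?_
    rw [uIoc_of_le hη.le] at hv
    rw [tendsto_zero_iff_norm_tendsto_zero]
    simp_rw [norm_airyExp]
    rw [← zero_mul (Real.exp (v ^ 3 / 3 - x * v))]
    refine Tendsto.mul_const _ (Real.tendsto_exp_atBot.comp ?_)
    exact hl.const_mul_atTop_of_neg (neg_lt_zero.2 hv.1)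

open Complex in
-- Cauchy's theorem on a rectangle moves the conditionally convergent integral to the line `Im z =
-- η`, where it converges absolutely.
lemma tendsto_integral_airyExp (x : ℝ) {η : ℝ} (hη : 0 < η) :
    Tendsto (fun T : ℝ => ∫ s in (-T)..T, airyExp x s) atTop (𝓝 (airyMoment 0 η x)) := by
  have hrect : ∀ T : ℝ, ∫ s in (-T)..T, airyExp x s =
      (∫ s in (-T)..T, airyExp x (s + η * I)) - I * (∫ v in (0 : ℝ)..η, airyExp x (T + v * I)) +
        I * (∫ v in (0 : ℝ)..η, airyExp x ((-T : ℝ) + v * I)) := by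
    intro T
    have := integral_boundary_rect_eq_zero_of_differentiableOn (airyExp x)
      ((-T : ℝ) : ℂ) (T + η * I) (differentiable_airyExp x).differentiableOn
    simp at this
    push_cast
    linear_combination this
  simp_rw [hrect]
  have h1 : Tendsto (fun T : ℝ => ∫ s in (-T)..T, airyExp x (s + η * I)) atTop
      (𝓝 (airyMoment 0 η x)) := by
    have h0 := integrable_airyMoment_integrand (k := 0) (by norm_num) hη x
    have := intervalIntegral_tendsto_integral h0 tendsto_neg_atTop_atBot tendsto_id
    simpa [airyMoment] using this
  have h2 := tendsto_airyExp_vertical x hη atTop (tendsto_pow_atTop two_ne_zero)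
  have h3 := tendsto_airyExp_vertical x hη atBot 
    (((tendsto_pow_atTop two_ne_zero).comp tendsto_neg_atBot_atTop).congr fun T => neg_sq T)
  have h4 := h3.comp tendsto_neg_atTop_atBot
  simpa using (h1.sub (h2.const_mul I)).add (h4.const_mul I)

open Complex in
lemma integral_airyExp_symm (x T : ℝ) :
    ∫ s in (-T)..T, airyExp x s = ((2 * ∫ s in (0 : ℝ)..T, Real.cos (s ^ 3 / 3 + x * s) : ℝ) : ℂ) := by
  have hi : ∀ a b : ℝ, IntervalIntegrable (fun s : ℝ => airyExp x s) volume a b := fun a b =>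
    Continuous.intervalIntegrable (by unfold airyExp; fun_prop) _ _
  rw [← intervalIntegral.integral_add_adjacent_intervals (hi (-T) 0) (hi 0 T)]
  have : ∫ s in (-T)..0, airyExp x s = ∫ s in (0 : ℝ)..T, airyExp x (-s : ℝ) := by
    rw [intervalIntegral.integral_comp_neg (fun s : ℝ => airyExp x s)]; simp
  rw [this, ← intervalIntegral.integral_add]
  · rw [← intervalIntegral.integral_const_mul, ← intervalIntegral.integral_ofReal]
    congr 1; ext s
    rw [airyExp_ofReal, airyExp_ofReal, show (-s) ^ 3 / 3 + x * -s = -(s ^ 3 / 3 + x * s) by ring,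
      Real.cos_neg, Real.sin_neg]
    push_cast; ring
  · exact Continuous.intervalIntegrable (by unfold airyExp; fun_prop) _ _
  · exact hi 0 T

/-- The contour representation of the Airy function. -/
lemma airyAi_eq_airyMoment (x : ℝ) {η : ℝ} (hη : 0 < η) :
    (airyAi x : ℂ) = (2 * Real.pi : ℝ)⁻¹ * airyMoment 0 η x := by
  have h := tendsto_integral_airyExp x hη
  simp_rw [integral_airyExp_symm] at h
  have hre := (Complex.continuous_re.tendsto _).comp h
  have him := (Complex.continuous_im.tendsto _).comp h
  simp only [Function.comp_def, Complex.ofReal_re, Complex.ofReal_im] at hre him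
  have h0 : (airyMoment 0 η x).im = 0 := tendsto_nhds_unique him tendsto_const_nhds
  have h1 : airyAi x = (2 * Real.pi)⁻¹ * (airyMoment 0 η x).re := by
    refine Tendsto.limUnder_eq ?_
    refine (hre.const_mul (2 * Real.pi)⁻¹).congr fun T => ?_
    field_simp
  rw [h1]
  apply Complex.ext <;> simp [h0]

lemma airyAi_eq_re (x : ℝ) : airyAi x = (2 * Real.pi)⁻¹ * (airyMoment 0 1 x).re := by
  have := congrArg Complex.re (airyAi_eq_airyMoment x one_pos)
  rwa [Complex.ofReal_re, Complex.re_ofReal_mul] at this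

lemma hasDerivAt_re_airyMoment {k : ℕ} (hk : k ≤ 1) (x : ℝ) :
    HasDerivAt (fun x => (2 * Real.pi)⁻¹ * (airyMoment k 1 x).re)
      ((2 * Real.pi)⁻¹ * (airyMoment (k + 1) 1 x).re) x := by
  have h := hasDerivAt_airyMoment hk one_pos x
  exact (Complex.reCLM.hasFDerivAt.comp_hasDerivAt x h).const_mul _

lemma hasDerivAt_airyAi_aux (x : ℝ) :
    HasDerivAt airyAi ((2 * Real.pi)⁻¹ * (airyMoment 1 1 x).re) x := by
  rw [funext airyAi_eq_re]; exact hasDerivAt_re_airyMoment (by norm_num) x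

lemma deriv_airyAi (x : ℝ) : deriv airyAi x = (2 * Real.pi)⁻¹ * (airyMoment 1 1 x).re :=
  (hasDerivAt_airyAi_aux x).deriv

lemma hasDerivAt_airyAi (x : ℝ) : HasDerivAt airyAi (deriv airyAi x) x :=
  (hasDerivAt_airyAi_aux x).differentiableAt.hasDerivAt

/-- Airy's equation. -/
lemma hasDerivAt_deriv_airyAi (x : ℝ) : HasDerivAt (deriv airyAi) (x * airyAi x) x := by
  rw [funext deriv_airyAi, airyAi_eq_re]
  refine (hasDerivAt_re_airyMoment le_rfl x).congr_deriv ?_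
  rw [airyMoment_two one_pos, Complex.re_ofReal_mul]; ring

lemma continuous_airyAi : Continuous airyAi :=
  continuous_iff_continuousAt.2 fun x => (hasDerivAt_airyAi x).continuousAt

lemma continuous_deriv_airyAi : Continuous (deriv airyAi) :=
  continuous_iff_continuousAt.2 fun x => (hasDerivAt_deriv_airyAi x).continuousAt

lemma exists_abs_re_airyMoment_le {k : ℕ} (hk : k ≤ 2) :
    ∃ C, ∀ x, |(2 * Real.pi)⁻¹ * (airyMoment k 1 x).re| ≤ C * Real.exp (-x) := by
  obtain ⟨C, hC⟩ := norm_airyMoment_le hk one_pos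
  refine ⟨(2 * Real.pi)⁻¹ * C, fun x => ?_⟩
  rw [abs_mul, abs_of_pos (by positivity), mul_assoc]
  have := hC x
  rw [one_mul] at this
  gcongr
  exact (Complex.abs_re_le_norm _).trans this

/-- Exponential decay of the Airy function and its derivative. -/
lemma exists_abs_airyAi_le_exp :
    ∃ C > 0, ∀ x, |airyAi x| ≤ C * Real.exp (-x) ∧ |deriv airyAi x| ≤ C * Real.exp (-x) := by
  obtain ⟨C₀, h₀⟩ := exists_abs_re_airyMoment_le (k := 0) (by norm_num)
  obtain ⟨C₁, h₁⟩ := exists_abs_re_airyMoment_le (k := 1) (by norm_num)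
  refine ⟨max (max C₀ C₁) 1, by positivity, fun x => ⟨?_, ?_⟩⟩
  · rw [airyAi_eq_re]
    refine (h₀ x).trans ?_
    gcongr; exact (le_max_left _ _).trans (le_max_left _ _)
  · rw [deriv_airyAi]
    refine (h₁ x).trans ?_
    gcongr; exact (le_max_right _ _).trans (le_max_left _ _)

/-! ### The Laplace transform of `Ai(-y)²`. -/

open scoped FourierTransform InnerProductSpace

/-- Plancherel's identity for a continuous integrable function with integrable transform. -/
lemma integral_norm_sq_fourier_eq {f : ℝ → ℂ} (hc : Continuous f) (hf : Integrable f)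
    (hf' : Integrable (𝓕 f)) : ∫ w, ‖𝓕 f w‖ ^ 2 = ∫ s, ‖f s‖ ^ 2 := by
  have h := VectorFourier.integral_sesq_fourierIntegral_eq_neg_flip (μ := volume) (ν := volume)
    (L := innerₗ ℝ) (innerSL ℂ (E := ℂ)) Real.continuous_fourierChar continuous_inner hf hf'
  have hinv := Continuous.fourierInv_fourier_eq hc hf hf'
  have key : ∫ w, inner ℂ (𝓕 f w) (𝓕 f w) = ∫ s, inner ℂ (f s) (f s) := by
    calc _ = ∫ s, inner ℂ (f s) (𝓕⁻ (𝓕 f) s) := by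
          simpa only [flip_innerₗ] using! h
      _ = _ := by rw [hinv]
  simp_rw [inner_self_eq_norm_sq_to_K] at key
  exact_mod_cast key

open Complex in
lemma fourier_airyExp {η : ℝ} (hη : 0 < η) (w : ℝ) :
    𝓕 (fun s : ℝ => airyExp 0 (s + η * I)) w =
      ((2 * Real.pi * (airyAi (-(2 * Real.pi * w)) * Real.exp (-(2 * Real.pi * w) * η)) : ℝ) : ℂ) := by
  rw [Real.fourier_real_eq_integral_exp_smul]
  push_cast [airyAi_eq_airyMoment _ hη, airyMoment]
  rw [mul_comm _ (cexp _), ← mul_assoc, ← mul_assoc, mul_comm _ (cexp _), mul_assoc, mul_assoc,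
    mul_inv_cancel_left₀ (by simp [Real.pi_ne_zero]), ← integral_const_mul]
  congr 1; ext s
  simp only [airyExp, smul_eq_mul, pow_zero, one_mul, ← Complex.exp_add]
  congr 1
  push_cast
  linear_combination (2 * Real.pi * w * η) * I_sq

/-- As `y → ∞` the exponential decays and `Ai` is bounded. As `y → -∞` it grows like `exp (η |y|)`,
which the decay `Ai(x) = O(exp (-x))` absorbs when `η < 1`. -/
lemma integrable_airyAi_neg_mul_exp {C : ℝ} (hC : ∀ x, |airyAi x| ≤ C) {η : ℝ} (h0 : 0 < η)
    (h1 : η < 1) : Integrable (fun y : ℝ => airyAi (-y) * Real.exp (-y * η)) := by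
  have hcont : Continuous (fun y : ℝ => airyAi (-y) * Real.exp (-y * η)) :=
    (continuous_airyAi.comp continuous_neg).mul (by fun_prop)
  rw [← integrableOn_univ, ← Iic_union_Ioi (a := (0 : ℝ)), integrableOn_union]
  constructor
  · obtain ⟨D, _, hD⟩ := exists_abs_airyAi_le_exp
    refine ((integrableOn_exp_mul_Iic (sub_pos.2 h1) 0).const_mul D).mono'
      hcont.aestronglyMeasurable (Eventually.of_forall fun y => ?_)
    rw [norm_mul, Real.norm_eq_abs, Real.norm_eq_abs, Real.abs_exp]
    calc _ ≤ D * Real.exp (-(-y)) * Real.exp (-y * η) := by gcongr; exact (hD (-y)).1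
      _ = _ := by rw [mul_assoc, ← Real.exp_add]; ring_nf
  · refine ((integrableOn_exp_mul_Ioi (neg_lt_zero.2 h0) 0).const_mul C).mono'
      hcont.aestronglyMeasurable (Eventually.of_forall fun y => ?_)
    rw [norm_mul, Real.norm_eq_abs, Real.norm_eq_abs, Real.abs_exp, neg_mul_comm, mul_comm y]
    gcongr
    exact hC _

lemma integrable_airyAi_sq_mul_exp {C : ℝ} (hC : ∀ x, |airyAi x| ≤ C) {p : ℝ} (h0 : 0 < p)
    (h1 : p < 1) : Integrable (fun y : ℝ => airyAi (-y) ^ 2 * Real.exp (-p * y)) := by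
  have h := integrable_airyAi_neg_mul_exp hC h0 h1
  refine (h.bdd_mul (c := C) (f := fun y => airyAi (-y))
    (continuous_airyAi.comp continuous_neg).aestronglyMeasurable
    (Eventually.of_forall fun y => hC _)).congr (Eventually.of_forall fun y => ?_)
  simp only
  rw [← mul_assoc, sq, neg_mul_comm, mul_comm y, neg_mul_comm]

open Complex in
/-- The Laplace transform of the square of the Airy function, by Plancherel's identity. -/
lemma integral_airyAi_sq_mul_exp {C : ℝ} (hC : ∀ x, |airyAi x| ≤ C) {η : ℝ} (h0 : 0 < η)
    (h1 : η < 1) : ∫ y : ℝ, airyAi (-y) ^ 2 * Real.exp (-(2 * η) * y) =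
      (2 * Real.pi)⁻¹ * (√(Real.pi / (2 * η)) * Real.exp (2 * η ^ 3 / 3)) := by
  have hpi : 0 < 2 * Real.pi := by positivity
  have hG : Continuous (fun s : ℝ => airyExp 0 (s + η * I)) := by unfold airyExp; fun_prop
  have hGi : Integrable (fun s : ℝ => airyExp 0 (s + η * I)) :=
    (integrable_airyMoment_integrand (k := 0) (by norm_num) h0 0).congr
      (Eventually.of_forall fun s => by simp)
  have hfi : Integrable (𝓕 (fun s : ℝ => airyExp 0 (s + η * I))) := by
    rw [funext (fourier_airyExp h0)]
    exact (((integrable_airyAi_neg_mul_exp hC h0 h1).comp_mul_left' hpi.ne').const_mul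
      (2 * Real.pi)).ofReal
  have key := integral_norm_sq_fourier_eq hG hGi hfi
  simp_rw [fourier_airyExp h0, norm_airyExp, norm_real, Real.norm_eq_abs, sq_abs, mul_pow,
    ← Real.exp_nat_mul] at key
  rw [integral_mul_const, integral_const_mul] at key
  have h2 := integral_gaussian (2 * η)
  have h3 := Measure.integral_comp_mul_left (fun y : ℝ => airyAi (-y) ^ 2 * Real.exp (-(2 * η) * y))
    (2 * Real.pi)
  rw [abs_of_pos (inv_pos.2 hpi), smul_eq_mul] at h3
  have e1 : ∫ s : ℝ, Real.exp ((2 : ℕ) * (-η * s ^ 2)) = √(Real.pi / (2 * η)) := by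
    rw [← h2]; congr 1; ext s; push_cast; ring_nf
  have e2 : ∫ w : ℝ, airyAi (-(2 * Real.pi * w)) ^ 2 *
      Real.exp ((2 : ℕ) * (-(2 * Real.pi * w) * η)) =
      (2 * Real.pi)⁻¹ * ∫ y : ℝ, airyAi (-y) ^ 2 * Real.exp (-(2 * η) * y) := by
    rw [← h3]; congr 1; ext w; push_cast; ring_nf
  rw [e1, e2, show ((2 : ℕ) : ℝ) * (η ^ 3 / 3 - 0 * η) = 2 * η ^ 3 / 3 by push_cast; ring] at key
  rw [← key]
  generalize (∫ y : ℝ, airyAi (-y) ^ 2 * Real.exp (-(2 * η) * y)) = J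
  field_simp

/-! ### The adiabatic energy and its convergence. -/

/-- The adiabatic energy `v² / √y + √y u²` of a solution `u`, with `v = u'`, of `u'' = -y u`. -/
noncomputable def airyEnergy (u v : ℝ → ℝ) (y : ℝ) : ℝ := v y ^ 2 / √y + √y * u y ^ 2

lemma airyEnergy_nonneg (u v : ℝ → ℝ) (y : ℝ) : 0 ≤ airyEnergy u v y := by
  unfold airyEnergy; positivity

lemma abs_mul_le_airyEnergy (u v : ℝ → ℝ) {y : ℝ} (hy : 0 < y) :
    |u y * v y| ≤ airyEnergy u v y / 2 := by
  have hq := Real.sqrt_pos.2 hy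
  have h : airyEnergy u v y = (v y ^ 2 + (√y * u y) ^ 2) / √y := by
    unfold airyEnergy; field_simp
  rw [h, div_div, le_div_iff₀ (by positivity), abs_mul, ← sq_abs (v y), ← sq_abs (√y * u y), abs_mul,
    abs_of_pos hq]
  nlinarith [sq_nonneg (|v y| - √y * |u y|)]

/-- The derivative of the energy, `u² / (2 √y) - v² / (2 y^{3/2})`, is not absolutely integrable in
general. Adding `u v / (2 y^{3/2})` cancels it and leaves only `-3 u v / (4 y^{5/2})`, which is `O(E
/ y^{5/2})`. An integrating factor tending to `1` then makes the corrected energy `H` decreasing,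
and `H` is bounded below. -/
lemma airyEnergy_tendsto {u v : ℝ → ℝ} (hu : ∀ y, HasDerivAt u (v y) y)
    (hv : ∀ y, HasDerivAt v (-(y * u y)) y) :
    ∃ L B, Tendsto (airyEnergy u v) atTop (𝓝 L) ∧ ∀ y, 1 ≤ y → airyEnergy u v y ≤ B := by
  set H : ℝ → ℝ := fun y =>
    (airyEnergy u v y + u y * v y / (2 * √y ^ 3)) * Real.exp (1 / (3 * √y ^ 3)) with hH
  have hGE : ∀ y, 1 ≤ y → |u y * v y / (2 * √y ^ 3)| ≤ airyEnergy u v y / (4 * √y ^ 3) := by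
    intro y hy
    have hq := Real.sqrt_pos.2 (zero_lt_one.trans_le hy)
    rw [abs_div, abs_of_pos (a := 2 * √y ^ 3) (by positivity),
      div_le_div_iff₀ (by positivity) (by positivity)]
    nlinarith [mul_le_mul_of_nonneg_right (abs_mul_le_airyEnergy u v (zero_lt_one.trans_le hy))
      (pow_pos hq 3).le]
  have hlow : ∀ y, 1 ≤ y → 3 / 4 * airyEnergy u v y ≤ H y := by
    intro y hy
    have hq1 : 1 ≤ √y := Real.one_le_sqrt.2 hy
    have hE := airyEnergy_nonneg u v y
    have h1 : airyEnergy u v y / (4 * √y ^ 3) ≤ airyEnergy u v y / 4 := by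
      gcongr
      nlinarith [one_le_pow₀ (n := 3) hq1]
    have h2 := (abs_le.1 (hGE y hy)).1
    have h3 : 1 ≤ Real.exp (1 / (3 * √y ^ 3)) := Real.one_le_exp (by positivity)
    have h4 : 3 / 4 * airyEnergy u v y ≤ airyEnergy u v y + u y * v y / (2 * √y ^ 3) := by linarith
    exact h4.trans (le_mul_of_one_le_right (by linarith) h3)
  have hder : ∀ y, 0 < y → HasDerivAt H (-(3 / 4 * (u y * v y) + airyEnergy u v y / 2 +
      u y * v y / (4 * √y ^ 3)) / √y ^ 5 * Real.exp (1 / (3 * √y ^ 3))) y := by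
    intro y hy
    have hq := Real.sqrt_pos.2 hy
    have hq2 : y = √y ^ 2 := (Real.sq_sqrt hy.le).symm
    have ds := Real.hasDerivAt_sqrt hy.ne'
    have d3 := ds.fun_pow 3
    have d1 : HasDerivAt (airyEnergy u v) _ y :=
      (((hv y).fun_pow 2).fun_div ds hq.ne').add (ds.fun_mul ((hu y).fun_pow 2))
    have d2 := ((hu y).fun_mul (hv y)).fun_div (d3.const_mul 2) (by positivity)
    have d4 := ((hasDerivAt_const y (1 : ℝ)).fun_div (d3.const_mul 3) (by positivity)).exp
    refine ((d1.fun_add d2).fun_mul d4).congr_deriv ?_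
    simp only [airyEnergy]
    generalize √y = q at *
    generalize Real.exp (1 / (3 * q ^ 3)) = e
    generalize u y = a
    generalize v y = b
    subst hq2
    field_simp
    ring
  have hanti : AntitoneOn H (Ici 1) := by
    refine antitoneOn_of_deriv_nonpos (convex_Ici 1)
      (fun y hy => (hder y (zero_lt_one.trans_le hy)).continuousAt.continuousWithinAt)
      (fun y hy => ?_) (fun y hy => ?_) <;> rw [interior_Ici, mem_Ioi] at hy
    · exact (hder y (zero_lt_one.trans hy)).differentiableAt.differentiableWithinAt
    · have h0 := zero_lt_one.trans hy
      have hq := Real.sqrt_pos.2 h0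
      rw [(hder y h0).deriv]
      -- The `1/3` in the exponent produces the term `E / 2`. With `|u v| ≤ E / 2` the other two
      -- terms are at least `-3E/8` and `-E/8`, which it exactly absorbs.
      refine mul_nonpos_of_nonpos_of_nonneg (div_nonpos_of_nonpos_of_nonneg ?_ (by positivity))
        (by positivity)
      have hq1 : 1 ≤ √y := Real.one_le_sqrt.2 hy.le
      have hE := airyEnergy_nonneg u v y
      have h1 : airyEnergy u v y / (4 * √y ^ 3) ≤ airyEnergy u v y / 4 := by
        gcongr
        nlinarith [one_le_pow₀ (n := 3) hq1]
      have h2 := (abs_le.1 (hGE y hy.le)).1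
      have h3 := (abs_le.1 (abs_mul_le_airyEnergy u v h0)).1
      have h4 : u y * v y / (4 * √y ^ 3) = u y * v y / (2 * √y ^ 3) / 2 := by ring
      rw [h4]
      linarith
  have hH0 : ∀ y, 1 ≤ y → 0 ≤ H y := fun y hy =>
    (mul_nonneg (by norm_num) (airyEnergy_nonneg u v y)).trans (hlow y hy)
  have hB : ∀ y, 1 ≤ y → airyEnergy u v y ≤ 4 / 3 * H 1 := fun y hy => by
    have := hanti self_mem_Ici (mem_Ici.2 hy) hy
    linarith [hlow y hy]
  have hlim : Tendsto (fun y => H (max 1 y)) atTop (𝓝 (⨅ y, H (max 1 y))) := by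
    refine tendsto_atTop_ciInf (fun x y hxy => ?_) ⟨0, ?_⟩
    · exact hanti (mem_Ici.2 (le_max_left _ _)) (mem_Ici.2 (le_max_left _ _)) (max_le_max_left _ hxy)
    · rintro _ ⟨y, rfl⟩; exact hH0 _ (le_max_left _ _)
  have hlim' : Tendsto H atTop (𝓝 (⨅ y, H (max 1 y))) :=
    hlim.congr' ((eventually_ge_atTop 1).mono fun y hy => by rw [max_eq_right hy])
  have hq : Tendsto (fun y : ℝ => √y ^ 3) atTop atTop :=
    (tendsto_pow_atTop three_ne_zero).comp Real.tendsto_sqrt_atTop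
  have hexp : Tendsto (fun y : ℝ => Real.exp (-(1 / (3 * √y ^ 3)))) atTop (𝓝 1) := by
    have h0 := ((hq.const_mul_atTop three_pos).const_div_atTop (1 : ℝ)).neg
    have h1 := (Real.continuous_exp.tendsto _).comp h0
    rwa [neg_zero, Real.exp_zero] at h1
  have herr : Tendsto (fun y => u y * v y / (2 * √y ^ 3)) atTop (𝓝 0) := by
    refine squeeze_zero_norm' (a := fun y => 4 / 3 * H 1 / (4 * √y ^ 3)) ?_
      ((hq.const_mul_atTop four_pos).const_div_atTop _)
    filter_upwards [eventually_ge_atTop 1] with y hy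
    have := Real.sqrt_pos.2 (zero_lt_one.trans_le hy)
    refine (hGE y hy).trans ?_
    gcongr
    exact hB y hy
  have := (hlim'.mul hexp).sub herr
  refine ⟨_, _, this.congr fun y => ?_, hB⟩
  simp only [hH]
  rw [mul_assoc, ← Real.exp_add, add_neg_cancel, Real.exp_zero]
  ring

lemma hasDerivAt_airyAi_neg (y : ℝ) :
    HasDerivAt (fun y => airyAi (-y)) (-deriv airyAi (-y)) y := by
  exact ((hasDerivAt_airyAi (-y)).comp y (hasDerivAt_neg y)).congr_deriv (by ring)

lemma hasDerivAt_neg_deriv_airyAi_neg (y : ℝ) :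
    HasDerivAt (fun y => -deriv airyAi (-y)) (-(y * airyAi (-y))) y := by
  exact ((hasDerivAt_deriv_airyAi (-y)).comp y (hasDerivAt_neg y)).neg.congr_deriv (by ring)

/-- The adiabatic energy of `y ↦ Ai (-y)`. -/
noncomputable def airyAiEnergy : ℝ → ℝ :=
  airyEnergy (fun y => airyAi (-y)) (fun y => -deriv airyAi (-y))

lemma airyAiEnergy_tendsto_aux :
    ∃ L B, Tendsto airyAiEnergy atTop (𝓝 L) ∧ ∀ y, 1 ≤ y → airyAiEnergy y ≤ B :=
  airyEnergy_tendsto hasDerivAt_airyAi_neg hasDerivAt_neg_deriv_airyAi_neg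

/-! ### Uniform bounds for `Ai` and `Ai'`. -/

lemma le_one_add_of_pow_four_le {t K : ℝ} (h : t ^ 4 ≤ K) : t ≤ 1 + K := by
  nlinarith [sq_nonneg (t ^ 2 - 1), sq_nonneg (t - 1), sq_nonneg (t + 1)]

lemma rpow_quarter_pow_four {x : ℝ} (hx : 0 ≤ x) : (x ^ (1 / 4 : ℝ)) ^ 4 = x := by
  rw [← Real.rpow_natCast, ← Real.rpow_mul hx]; norm_num

/-- The uniform bounds `Ai(x) = O((1 + |x|)^{-1/4})` and `Ai'(x) = O((1 + |x|)^{1/4})`. -/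
lemma exists_airyAi_bounds : ∃ C > 0, ∀ x, |airyAi x| * (1 + |x|) ^ (1 / 4 : ℝ) ≤ C ∧
    |deriv airyAi x| ≤ C * (1 + |x|) ^ (1 / 4 : ℝ) := by
  obtain ⟨L, B, -, hB⟩ := airyAiEnergy_tendsto_aux
  obtain ⟨D, hD0, hD⟩ := exists_abs_airyAi_le_exp
  have he : 0 < Real.exp 1 := Real.exp_pos 1
  -- For `x ≤ -1` the energy bound is squared so that the quarter powers become fourth powers, and
  -- `1 + |x| ≤ 2|x|` gives `2 B²`. The last summand serves `x ≥ -1`, where exponential decay is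
  -- enough.
  refine ⟨1 + 2 * B ^ 2 + 2 * (D * Real.exp 1), by positivity, fun x => ?_⟩
  have hQ0 : (0 : ℝ) ≤ 1 + |x| := by positivity
  have hQ4 := rpow_quarter_pow_four hQ0
  have hQ1 : 1 ≤ (1 + |x|) ^ (1 / 4 : ℝ) :=
    Real.one_le_rpow (by linarith [abs_nonneg x]) (by norm_num)
  have hQ2 : (1 + |x|) ^ (1 / 4 : ℝ) ≤ 1 + |x| :=
    Real.rpow_le_self_of_one_le (by linarith [abs_nonneg x]) (by norm_num)
  set Q := (1 + |x|) ^ (1 / 4 : ℝ)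
  rcases le_total x (-1) with hx | hx
  · have hy : 1 ≤ -x := by linarith
    have hy0 : 0 < -x := by linarith
    have hq := Real.sqrt_pos.2 hy0
    have hq2 : √(-x) ^ 2 = -x := Real.sq_sqrt hy0.le
    have hE := hB _ hy
    simp only [airyAiEnergy, airyEnergy, neg_neg, neg_sq] at hE
    rw [abs_of_neg (by linarith : x < 0)] at hQ4
    have h1 : √(-x) * airyAi x ^ 2 ≤ B :=
      le_trans (le_add_of_nonneg_left (by positivity)) hE
    have h2 : deriv airyAi x ^ 2 ≤ B * √(-x) := by
      rw [← div_le_iff₀ hq]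
      exact le_trans (le_add_of_nonneg_right (by positivity)) hE
    have h1' : (√(-x) * airyAi x ^ 2) ^ 2 ≤ B ^ 2 := by gcongr
    have h2' : (deriv airyAi x ^ 2) ^ 2 ≤ (B * √(-x)) ^ 2 := by gcongr
    rw [mul_pow, hq2] at h1' h2'
    have hDe : 0 ≤ D * Real.exp 1 := by positivity
    constructor
    · have : (|airyAi x| * Q) ^ 4 ≤ 2 * B ^ 2 := by
        rw [mul_pow, hQ4, Even.pow_abs (by decide : Even 4)]
        nlinarith [mul_nonneg (by linarith : (0:ℝ) ≤ -x - 1) (sq_nonneg (airyAi x ^ 2))]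
      linarith [le_one_add_of_pow_four_le this]
    · rw [← div_le_iff₀ (by linarith)]
      have : (|deriv airyAi x| / Q) ^ 4 ≤ B ^ 2 := by
        rw [div_pow, hQ4, Even.pow_abs (by decide : Even 4), div_le_iff₀ (by linarith)]
        nlinarith [sq_nonneg B]
      linarith [le_one_add_of_pow_four_le this, sq_nonneg B]
  · have h1 : (1 + |x|) * Real.exp (-x) ≤ 2 * Real.exp 1 := by
      rcases le_total 0 x with h0 | h0
      · rw [abs_of_nonneg h0, Real.exp_neg, ← div_eq_mul_inv, div_le_iff₀ (Real.exp_pos x)]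
        nlinarith [Real.add_one_le_exp x, Real.add_one_le_exp (1 : ℝ), Real.exp_pos x]
      · rw [abs_of_nonpos h0]
        have : Real.exp (-x) ≤ Real.exp 1 := Real.exp_le_exp.2 (by linarith)
        nlinarith [Real.exp_pos (-x)]
    have h2 : Real.exp (-x) ≤ 2 * Real.exp 1 :=
      (le_mul_of_one_le_left (Real.exp_pos _).le (by linarith [abs_nonneg x])).trans h1
    constructor
    · calc |airyAi x| * Q ≤ (D * Real.exp (-x)) * (1 + |x|) := by
            gcongr; exact (hD x).1
        _ = D * ((1 + |x|) * Real.exp (-x)) := by ring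
        _ ≤ D * (2 * Real.exp 1) := by gcongr
        _ ≤ _ := by linarith [sq_nonneg B]
    · calc |deriv airyAi x| ≤ D * Real.exp (-x) := (hD x).2
        _ ≤ D * (2 * Real.exp 1) := by gcongr
        _ ≤ (1 + 2 * B ^ 2 + 2 * (D * Real.exp 1)) := by linarith [sq_nonneg B]
        _ ≤ _ := le_mul_of_one_le_right (by positivity) hQ1

lemma exists_abs_airyAi_le : ∃ C > 0, ∀ x, |airyAi x| ≤ C := by
  obtain ⟨C, hC0, hC⟩ := exists_airyAi_bounds
  refine ⟨C, hC0, fun x => le_trans ?_ (hC x).1⟩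
  exact le_mul_of_one_le_right (abs_nonneg _)
    (Real.one_le_rpow (by linarith [abs_nonneg x]) (by norm_num))

/-! ### The limit of the Airy energy. -/

/-- An Abelian theorem: the Laplace transform of a function asymptotic to `L / √y`. -/
lemma tendsto_sqrt_mul_integral_exp {E : ℝ → ℝ} (hm : Measurable E) {L B : ℝ}
    (hL : Tendsto E atTop (𝓝 L)) (hB : ∀ y, 1 ≤ y → |E y| ≤ B) :
    Tendsto (fun p : ℝ => √p * ∫ y in Ioi (1 : ℝ), Real.exp (-p * y) * (E y / √y))
      (𝓝[>] 0) (𝓝 (√Real.pi * L)) := by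
  have hG : IntegrableOn (fun t : ℝ => Real.exp (-t) * t ^ ((1 / 2 : ℝ) - 1)) (Ioi 0) :=
    Real.GammaIntegral_convergent one_half_pos
  have hGv : ∫ t in Ioi (0 : ℝ), Real.exp (-t) * t ^ ((1 / 2 : ℝ) - 1) = √Real.pi := by
    rw [← Real.Gamma_eq_integral one_half_pos, Real.Gamma_one_half_eq]
  have hpow : ∀ t : ℝ, 0 < t → t ^ ((1 / 2 : ℝ) - 1) = (√t)⁻¹ := fun t ht => by
    rw [Real.sqrt_eq_rpow, ← Real.rpow_neg ht.le]; norm_num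
  -- This is the integral after the substitution `t = p y`. The range `y > 1` becomes `t > p`, and
  -- the limit is `L Γ(1/2)`.
  have hlim : Tendsto (fun p : ℝ => ∫ t in Ioi (0 : ℝ),
      (Ioi p).indicator (fun t => Real.exp (-t) * t ^ ((1 / 2 : ℝ) - 1) * E (t / p)) t)
      (𝓝[>] 0) (𝓝 (∫ t in Ioi (0 : ℝ), Real.exp (-t) * t ^ ((1 / 2 : ℝ) - 1) * L)) := by
    refine tendsto_integral_filter_of_dominated_convergence
      (fun t => Real.exp (-t) * t ^ ((1 / 2 : ℝ) - 1) * B) ?_ ?_ (hG.mul_const B) ?_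
    · refine Eventually.of_forall fun p => Measurable.aestronglyMeasurable ?_
      refine Measurable.indicator ?_ measurableSet_Ioi
      have := hm.comp (measurable_id.div_const p)
      simp only [Function.comp_def, id] at this
      fun_prop
    · filter_upwards [self_mem_nhdsWithin] with p (hp : 0 < p)
      filter_upwards [ae_restrict_mem measurableSet_Ioi] with t (ht : 0 < t)
      rw [Set.indicator_apply]
      split_ifs with h
      · rw [norm_mul, Real.norm_of_nonneg (by positivity)]
        gcongr
        exact hB _ ((one_le_div hp).2 (le_of_lt h))
      · rw [norm_zero]
        have : 0 ≤ B := (abs_nonneg _).trans (hB 1 le_rfl)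
        positivity
    · filter_upwards [ae_restrict_mem measurableSet_Ioi] with t (ht : 0 < t)
      have h1 : Tendsto (fun p : ℝ => t / p) (𝓝[>] 0) atTop := by
        simpa [div_eq_mul_inv] using tendsto_inv_nhdsGT_zero.const_mul_atTop ht
      refine ((hL.comp h1).const_mul _).congr' ?_
      filter_upwards [Ioo_mem_nhdsGT ht] with p hp
      rw [Set.indicator_of_mem (mem_Ioi.2 hp.2), Function.comp]
  rw [integral_mul_const, hGv] at hlim
  refine hlim.congr' ?_
  filter_upwards [self_mem_nhdsWithin] with p (hp : 0 < p)
  rw [setIntegral_indicator measurableSet_Ioi, inter_eq_right.2 (Ioi_subset_Ioi hp.le)]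
  have h := integral_comp_mul_left_Ioi
    (fun t => Real.exp (-t) * t ^ ((1 / 2 : ℝ) - 1) * E (t / p)) 1 hp
  rw [mul_one, smul_eq_mul, eq_inv_mul_iff_mul_eq₀ hp.ne'] at h
  rw [← h, ← integral_const_mul, ← integral_const_mul]
  refine setIntegral_congr_fun measurableSet_Ioi fun y (hy : 1 < y) => ?_
  have hy0 : 0 < y := zero_lt_one.trans hy
  rw [hpow _ (mul_pos hp hy0), Real.sqrt_mul hp.le, mul_div_cancel_left₀ _ hp.ne', neg_mul]
  have h1 := Real.sqrt_pos.2 hp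
  have h2 := Real.sqrt_pos.2 hy0
  have h3 := Real.sq_sqrt hp.le
  field_simp
  rw [h3]

lemma continuous_airyAi_neg : Continuous (fun y => airyAi (-y)) :=
  continuous_airyAi.comp continuous_neg

lemma continuous_neg_deriv_airyAi_neg : Continuous (fun y => -deriv airyAi (-y)) :=
  (continuous_deriv_airyAi.comp continuous_neg).neg

lemma measurable_airyAiEnergy : Measurable airyAiEnergy := by
  have h1 := continuous_airyAi_neg.measurable
  have h2 := continuous_neg_deriv_airyAi_neg.measurable
  unfold airyAiEnergy airyEnergy
  fun_prop

lemma abs_airyAiEnergy (y : ℝ) : |airyAiEnergy y| = airyAiEnergy y :=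
  abs_of_nonneg (airyEnergy_nonneg _ _ y)

lemma hasDerivAt_neg_exp_div {p y : ℝ} (hy : 0 < y) :
    HasDerivAt (fun y => -(Real.exp (-p * y) / y)) (Real.exp (-p * y) * (p / y + 1 / y ^ 2)) y := by
  have h1 : HasDerivAt (fun y => Real.exp (-p * y)) (Real.exp (-p * y) * -p) y := by
    simpa using ((hasDerivAt_id y).const_mul (-p)).exp
  refine (h1.fun_div (hasDerivAt_id y) hy.ne').neg.congr_deriv ?_
  simp only [id]
  field_simp
  ring

lemma tendsto_exp_neg_mul_div {p : ℝ} (hp : 0 < p) :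
    Tendsto (fun y => Real.exp (-p * y) / y) atTop (𝓝 0) := by
  have h1 : Tendsto (fun y : ℝ => Real.exp (-p * y)) atTop (𝓝 0) :=
    Real.tendsto_exp_atBot.comp (tendsto_id.const_mul_atTop_of_neg (neg_lt_zero.2 hp))
  exact h1.div_atTop tendsto_id

/-- Integrating by parts, `2 ∫ exp (-p y) Ai(-y)²` is, up to a bounded error, the Laplace transform
of `airyAiEnergy y / √y`. -/
lemma exists_abs_integral_airyAi_sq_sub_le : ∃ K, ∀ p ∈ Ioo (0 : ℝ) 1,
    |(∫ y : ℝ, airyAi (-y) ^ 2 * Real.exp (-p * y)) -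
      (∫ y in Ioi (1 : ℝ), Real.exp (-p * y) * (airyAiEnergy y / √y)) / 2| ≤ K := by
  obtain ⟨L, B, -, hB⟩ := airyAiEnergy_tendsto_aux
  obtain ⟨C, hC0, hC⟩ := exists_abs_airyAi_le
  have hB0 : 0 ≤ B := (airyEnergy_nonneg _ _ 1).trans (hB 1 le_rfl)
  obtain ⟨D, hD0, hD⟩ := exists_abs_airyAi_le_exp
  refine ⟨D ^ 2 * Real.exp 1 * Real.exp 1 + B, fun p hp => ?_⟩
  have hpos : ∀ y ∈ Ioi (1 : ℝ), 0 < y := fun y hy => zero_lt_one.trans hy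
  have huv : ∀ y, 1 ≤ y → |airyAi (-y) * -deriv airyAi (-y)| ≤ B / 2 := fun y hy =>
    (abs_mul_le_airyEnergy (fun y => airyAi (-y)) (fun y => -deriv airyAi (-y))
      (zero_lt_one.trans_le hy)).trans
        (div_le_div_of_nonneg_right (hB y hy) two_pos.le)
  -- `k` is the derivative of `-exp (-p y) / y`. It is nonnegative with total mass `exp (-p) ≤ 1` on
  -- `(1, ∞)`, so the error it carries is bounded uniformly in `p`.
  set k : ℝ → ℝ := fun y => Real.exp (-p * y) * (p / y + 1 / y ^ 2) with hkdef
  have hk0 : ∀ y ∈ Ioi (1 : ℝ), 0 ≤ k y := fun y hy => by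
    have := hpos y hy; have := hp.1; simp only [hkdef]; positivity
  have hkt : Tendsto (fun y => -(Real.exp (-p * y) / y)) atTop (𝓝 0) := by
    simpa using (tendsto_exp_neg_mul_div hp.1).neg
  have hkd : ∀ y ∈ Ici (1 : ℝ), HasDerivAt (fun y => -(Real.exp (-p * y) / y)) (k y) y :=
    fun y hy => hasDerivAt_neg_exp_div (zero_lt_one.trans_le hy)
  have hki : IntegrableOn k (Ioi 1) := integrableOn_Ioi_deriv_of_nonneg' hkd hk0 hkt
  have hkI : ∫ y in Ioi 1, k y = Real.exp (-p) := by
    rw [integral_Ioi_of_hasDerivAt_of_tendsto' hkd hki hkt]; simp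
  have hkm : AEStronglyMeasurable k (volume.restrict (Ioi 1)) := hki.aestronglyMeasurable
  have huvk_le : ∀ᵐ y ∂(volume.restrict (Ioi (1 : ℝ))),
      ‖airyAi (-y) * -deriv airyAi (-y) * k y‖ ≤ B / 2 * k y := by
    filter_upwards [ae_restrict_mem measurableSet_Ioi] with y hy
    rw [norm_mul, Real.norm_of_nonneg (hk0 y hy)]
    exact mul_le_mul_of_nonneg_right (huv y (le_of_lt hy)) (hk0 y hy)
  have huvk : IntegrableOn (fun y => airyAi (-y) * -deriv airyAi (-y) * k y) (Ioi 1) :=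
    (hki.const_mul (B / 2)).mono' ((continuous_airyAi_neg.mul
      continuous_neg_deriv_airyAi_neg).aestronglyMeasurable.mul hkm) huvk_le
  have hu2 := integrable_airyAi_sq_mul_exp hC hp.1 hp.2
  have hE : IntegrableOn (fun y => Real.exp (-p * y) * (airyAiEnergy y / √y)) (Ioi 1) := by
    refine ((integrableOn_exp_mul_Ioi (neg_lt_zero.2 hp.1) 1).const_mul B).mono' ?_ ?_
    · have := measurable_airyAiEnergy
      exact Measurable.aestronglyMeasurable (by fun_prop)
    · filter_upwards [ae_restrict_mem measurableSet_Ioi] with y (hy : 1 < y)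
      rw [norm_mul, Real.norm_of_nonneg (Real.exp_pos _).le, mul_comm, norm_div,
        Real.norm_eq_abs, abs_airyAiEnergy, Real.norm_of_nonneg (Real.sqrt_nonneg _)]
      gcongr
      exact (div_le_self (airyEnergy_nonneg _ _ y) (Real.one_le_sqrt.2 hy.le)).trans (hB y hy.le)
  -- With `u = Ai(-y)` and `v = u'`, one has `(u v)' = v² - y u²` and `E / √y = v² / y + u²`, hence
  -- `-(u v)' / y = 2 u² - E / √y`.
  have hW : ∀ y ∈ Ici (1 : ℝ), HasDerivAt
      (fun y => -(Real.exp (-p * y) / y) * (airyAi (-y) * -deriv airyAi (-y)))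
      (airyAi (-y) * -deriv airyAi (-y) * k y + 2 * (airyAi (-y) ^ 2 * Real.exp (-p * y)) -
        Real.exp (-p * y) * (airyAiEnergy y / √y)) y := by
    intro y hy
    have hy0 : 0 < y := zero_lt_one.trans_le hy
    refine ((hkd y hy).mul ((hasDerivAt_airyAi_neg y).mul
      (hasDerivAt_neg_deriv_airyAi_neg y))).congr_deriv ?_
    have hq := Real.sqrt_pos.2 hy0
    have hE' : airyAiEnergy y / √y = deriv airyAi (-y) ^ 2 / y + airyAi (-y) ^ 2 := by
      simp only [airyAiEnergy, airyEnergy]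
      rw [neg_sq, add_div, div_div, Real.mul_self_sqrt hy0.le, mul_div_cancel_left₀ _ hq.ne']
    rw [hE']
    simp only [Pi.mul_apply]
    field_simp
    ring
  have hWt : Tendsto (fun y => -(Real.exp (-p * y) / y) * (airyAi (-y) * -deriv airyAi (-y))) atTop
      (𝓝 0) := by
    refine squeeze_zero_norm' (a := fun y => Real.exp (-p * y) / y * (B / 2)) ?_
      (by simpa using (tendsto_exp_neg_mul_div hp.1).mul_const (B / 2))
    filter_upwards [eventually_ge_atTop 1] with y hy
    have hy0 : 0 < y := zero_lt_one.trans_le hy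
    rw [norm_mul, norm_neg, Real.norm_of_nonneg (by positivity)]
    gcongr
    exact huv y hy
  have hsum : IntegrableOn (fun y => airyAi (-y) * -deriv airyAi (-y) * k y +
      2 * (airyAi (-y) ^ 2 * Real.exp (-p * y))) (Ioi 1) :=
    huvk.add (hu2.integrableOn.const_mul 2)
  have hparts := integral_Ioi_of_hasDerivAt_of_tendsto' hW (hsum.sub hE) hWt
  rw [integral_sub hsum hE,
    integral_add huvk (hu2.integrableOn.const_mul 2), integral_const_mul] at hparts
  have hb1 : |∫ y in Ioi (1 : ℝ), airyAi (-y) * -deriv airyAi (-y) * k y| ≤ B / 2 := by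
    refine (norm_integral_le_of_norm_le (hki.const_mul (B / 2)) huvk_le).trans ?_
    rw [integral_const_mul, hkI]
    exact mul_le_of_le_one_right (by positivity) (Real.exp_le_one_iff.2 (by linarith [hp.1]))
  have hb2 : |-(Real.exp (-p * 1) / 1) * (airyAi (-1) * -deriv airyAi (-1))| ≤ B / 2 := by
    rw [abs_mul, abs_neg, div_one, abs_of_pos (Real.exp_pos _)]
    exact (mul_le_of_le_one_left (abs_nonneg _)
      (Real.exp_le_one_iff.2 (by linarith [hp.1]))).trans (huv 1 le_rfl)
  have hle : ∀ᵐ y ∂(volume.restrict (Iic (1 : ℝ))),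
      ‖airyAi (-y) ^ 2 * Real.exp (-p * y)‖ ≤ D ^ 2 * Real.exp 1 * Real.exp y := by
    filter_upwards [ae_restrict_mem measurableSet_Iic] with y (hy : y ≤ 1)
    rw [Real.norm_of_nonneg (by positivity), ← sq_abs]
    calc |airyAi (-y)| ^ 2 * Real.exp (-p * y)
        ≤ (D * Real.exp (-(-y))) ^ 2 * Real.exp (1 - y) := by
          gcongr
          · exact (hD (-y)).1
          · nlinarith [hp.1, hp.2]
      _ = D ^ 2 * Real.exp 1 * Real.exp y := by
          rw [mul_pow, ← Real.exp_nat_mul, mul_assoc, mul_assoc, ← Real.exp_add, ← Real.exp_add]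
          congr 2; push_cast; ring
  have hb3 : |∫ y in Iic (1 : ℝ), airyAi (-y) ^ 2 * Real.exp (-p * y)| ≤
      D ^ 2 * Real.exp 1 * Real.exp 1 :=
    (norm_integral_le_of_norm_le ((integrableOn_exp_Iic 1).const_mul _) hle).trans_eq
      (by rw [integral_const_mul, integral_exp_Iic])
  rw [← intervalIntegral.integral_Iic_add_Ioi (b := 1) hu2.integrableOn hu2.integrableOn]
  rw [abs_le] at *
  constructor <;> linarith

/-- The energy of the Airy function tends to `1 / π`. -/
lemma tendsto_airyAiEnergy : Tendsto airyAiEnergy atTop (𝓝 (1 / Real.pi)) := by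
  obtain ⟨L, B, hL, hB⟩ := airyAiEnergy_tendsto_aux
  obtain ⟨C, hC0, hC⟩ := exists_abs_airyAi_le
  obtain ⟨K, hK⟩ := exists_abs_integral_airyAi_sq_sub_le
  have h1 := (tendsto_sqrt_mul_integral_exp measurable_airyAiEnergy hL
    (fun y hy => (abs_airyAiEnergy y).trans_le (hB y hy))).div_const 2
  have hsq : Tendsto (fun p : ℝ => √p) (𝓝[>] 0) (𝓝 0) := by
    simpa using (Real.continuous_sqrt.tendsto 0).mono_left nhdsWithin_le_nhds
  have hmem : Ioo (0 : ℝ) 1 ∈ 𝓝[>] (0 : ℝ) := Ioo_mem_nhdsGT one_pos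
  have h2 : Tendsto (fun p : ℝ => √p * ((∫ y : ℝ, airyAi (-y) ^ 2 * Real.exp (-p * y)) -
      (∫ y in Ioi (1 : ℝ), Real.exp (-p * y) * (airyAiEnergy y / √y)) / 2)) (𝓝[>] 0) (𝓝 0) := by
    refine squeeze_zero_norm' (a := fun p => √p * K) ?_ (by simpa using hsq.mul_const K)
    filter_upwards [hmem] with p hp
    rw [norm_mul, Real.norm_of_nonneg (Real.sqrt_nonneg p)]
    exact mul_le_mul_of_nonneg_left (hK p hp) (Real.sqrt_nonneg p)
  have h3 : Tendsto (fun p : ℝ => √p * ∫ y : ℝ, airyAi (-y) ^ 2 * Real.exp (-p * y)) (𝓝[>] 0)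
      (𝓝 (√Real.pi * L / 2)) := by
    have := h2.add h1
    rw [zero_add] at this
    refine this.congr fun p => ?_
    generalize (∫ y : ℝ, airyAi (-y) ^ 2 * Real.exp (-p * y)) = J
    ring
  -- The exact transform with `η = p / 2`. Equating this limit with the previous one determines `L`.
  have h4 : Tendsto (fun p : ℝ => √p * ∫ y : ℝ, airyAi (-y) ^ 2 * Real.exp (-p * y)) (𝓝[>] 0)
      (𝓝 ((2 * Real.pi)⁻¹ * √Real.pi)) := by
    have : Tendsto (fun p : ℝ => (2 * Real.pi)⁻¹ * (√Real.pi * Real.exp (2 * (p / 2) ^ 3 / 3)))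
        (𝓝[>] 0) (𝓝 ((2 * Real.pi)⁻¹ * √Real.pi)) := by
      have hc : Continuous
          (fun p : ℝ => (2 * Real.pi)⁻¹ * (√Real.pi * Real.exp (2 * (p / 2) ^ 3 / 3))) := by fun_prop
      simpa using (hc.tendsto 0).mono_left nhdsWithin_le_nhds
    refine this.congr' ?_
    filter_upwards [hmem] with p hp
    have := integral_airyAi_sq_mul_exp hC (half_pos hp.1) (by linarith [hp.2])
    rw [mul_div_cancel₀ p two_ne_zero] at this
    rw [this, Real.sqrt_div Real.pi_pos.le]
    have := Real.sqrt_pos.2 hp.1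
    field_simp
  have h5 := tendsto_nhds_unique h3 h4
  have hp := Real.sqrt_pos.2 Real.pi_pos
  have : L = 1 / Real.pi := by
    field_simp at h5 ⊢
    linarith
  rwa [← this]

/-! ### The Dirichlet integral. -/

/-- The integrand of the Laplace representation of the complementary sine integral. -/
noncomputable def sineIntegrand (T y : ℝ) : ℝ :=
  Real.exp (-T * y) * (Real.cos T + y * Real.sin T) / (1 + y ^ 2)

lemma continuous_sineIntegrand (T : ℝ) : Continuous (sineIntegrand T) := by
  unfold sineIntegrand
  exact Continuous.div (by fun_prop) (by fun_prop) fun y => by positivity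

lemma abs_sineIntegrand_le (T : ℝ) {y : ℝ} (hy : 0 < y) :
    ‖sineIntegrand T y‖ ≤ 2 * Real.exp (-T * y) := by
  rw [sineIntegrand, norm_div, norm_mul, Real.norm_of_nonneg (Real.exp_pos _).le,
    Real.norm_of_nonneg (by positivity : 0 ≤ 1 + y ^ 2), div_le_iff₀ (by positivity)]
  have h : ‖Real.cos T + y * Real.sin T‖ ≤ 2 * (1 + y ^ 2) := by
    calc _ ≤ |Real.cos T| + |y * Real.sin T| := abs_add_le _ _
      _ ≤ 1 + y * 1 := by
        rw [abs_mul, abs_of_pos hy]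
        gcongr
        · exact Real.abs_cos_le_one T
        · exact Real.abs_sin_le_one T
      _ ≤ _ := by nlinarith [sq_nonneg (y - 1)]
  nlinarith [mul_le_mul_of_nonneg_left h (Real.exp_pos (-T * y)).le]

/-- Differentiating in `T` cancels the denominator `1 + y²` and leaves `-exp (-T y) sin T`, whose
integral is elementary. -/
lemma hasDerivAt_integral_sineIntegrand {T : ℝ} (hT : 0 < T) :
    HasDerivAt (fun T => ∫ y in Ioi (0 : ℝ), sineIntegrand T y) (-Real.sinc T) T := by
  have h := (hasDerivAt_integral_of_dominated_loc_of_deriv_le (μ := volume.restrict (Ioi (0 : ℝ)))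
    (F := sineIntegrand) (F' := fun T y => -(Real.exp (-T * y) * Real.sin T))
    (bound := fun y => Real.exp (-(T / 2) * y)) (Ioi_mem_nhds (half_lt_self hT))
    (Eventually.of_forall fun S => (continuous_sineIntegrand S).aestronglyMeasurable)
    (((integrableOn_exp_mul_Ioi (neg_lt_zero.2 hT) 0).const_mul 2).mono'
      (continuous_sineIntegrand T).aestronglyMeasurable ?_)
    (Continuous.aestronglyMeasurable (by fun_prop)) ?_
    (integrableOn_exp_mul_Ioi (neg_lt_zero.2 (half_pos hT)) 0) ?_).2
  · refine h.congr_deriv ?_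
    rw [integral_neg, integral_mul_const, integral_exp_mul_Ioi (neg_lt_zero.2 hT),
      Real.sinc_of_ne_zero hT.ne']
    simp
    ring
  · filter_upwards [ae_restrict_mem measurableSet_Ioi] with y hy
    exact abs_sineIntegrand_le T hy
  · filter_upwards [ae_restrict_mem measurableSet_Ioi] with y (hy : 0 < y) S (hS : T / 2 < S)
    rw [norm_neg, norm_mul, Real.norm_of_nonneg (Real.exp_pos _).le]
    refine (mul_le_of_le_one_right (Real.exp_pos _).le (Real.abs_sin_le_one S)).trans ?_
    gcongr
  · refine Eventually.of_forall fun y S _ => ?_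
    have h1 : HasDerivAt (fun S => Real.exp (-S * y)) (Real.exp (-S * y) * (-1 * y)) S :=
      ((hasDerivAt_neg S).mul_const y).exp
    have h2 := (Real.hasDerivAt_cos S).fun_add ((Real.hasDerivAt_sin S).const_mul y)
    refine ((h1.fun_mul h2).div_const (1 + y ^ 2)).congr_deriv ?_
    field_simp
    ring

/-- The bound `|cos T + y sin T| ≤ 1 + T y ≤ exp (T y)` compensates `exp (-T y)`, which gives a
majorant independent of `T`. -/
lemma tendsto_integral_sineIntegrand_zero :
    Tendsto (fun T => ∫ y in Ioi (0 : ℝ), sineIntegrand T y) (𝓝[>] 0) (𝓝 (Real.pi / 2)) := by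
  have hI : ∫ y in Ioi (0 : ℝ), (1 + y ^ 2)⁻¹ = Real.pi / 2 := by
    rw [integral_Ioi_inv_one_add_sq, Real.arctan_zero, sub_zero]
  rw [← hI]
  refine tendsto_integral_filter_of_dominated_convergence (fun y => 2 * (1 + y ^ 2)⁻¹)
    (Eventually.of_forall fun S => (continuous_sineIntegrand S).aestronglyMeasurable) ?_
    (integrable_inv_one_add_sq.integrableOn.const_mul 2) ?_
  · filter_upwards [self_mem_nhdsWithin] with T (hT : 0 < T)
    filter_upwards [ae_restrict_mem measurableSet_Ioi] with y (hy : 0 < y)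
    rw [sineIntegrand, norm_div, norm_mul, Real.norm_of_nonneg (Real.exp_pos _).le,
      Real.norm_of_nonneg (by positivity : 0 ≤ 1 + y ^ 2), ← div_eq_mul_inv]
    gcongr
    have h1 : ‖Real.cos T + y * Real.sin T‖ ≤ 1 + T * y := by
      refine (abs_add_le _ _).trans ?_
      rw [abs_mul, abs_of_pos hy, mul_comm T]
      gcongr
      · exact Real.abs_cos_le_one T
      · exact Real.abs_sin_le_abs.trans_eq (abs_of_pos hT)
    have h2 : 1 + T * y ≤ Real.exp (T * y) := by linarith [Real.add_one_le_exp (T * y)]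
    calc _ ≤ Real.exp (-T * y) * Real.exp (T * y) := by gcongr; exact h1.trans h2
      _ ≤ 2 := by rw [← Real.exp_add]; simp
  · refine Eventually.of_forall fun y => ?_
    have hc : Continuous (fun T => sineIntegrand T y) := by unfold sineIntegrand; fun_prop
    have := (hc.tendsto 0).mono_left (nhdsWithin_le_nhds (s := Ioi 0))
    simpa [sineIntegrand] using this

/-- The Dirichlet integral. -/
lemma tendsto_integral_sinc :
    Tendsto (fun T : ℝ => ∫ s in (0 : ℝ)..T, Real.sinc s) atTop (𝓝 (Real.pi / 2)) := by
  have hd : ∀ T, HasDerivAt (fun T : ℝ => ∫ s in (0 : ℝ)..T, Real.sinc s) (Real.sinc T) T :=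
    fun T => intervalIntegral.integral_hasDerivAt_right
      (Real.continuous_sinc.intervalIntegrable _ _)
      (Real.continuous_sinc.stronglyMeasurableAtFilter _ _) Real.continuous_sinc.continuousAt
  -- `Φ` is constant on `(0, ∞)`. Its limit at `0` gives the value `π / 2`, and its second term
  -- vanishes at infinity.
  set Φ : ℝ → ℝ := fun T => (∫ s in (0 : ℝ)..T, Real.sinc s) + ∫ y in Ioi (0 : ℝ), sineIntegrand T y
    with hΦ
  have hΦd : ∀ T ∈ Ioi (0 : ℝ), HasDerivAt Φ 0 T := fun T hT =>
    ((hd T).fun_add (hasDerivAt_integral_sineIntegrand hT)).congr_deriv (by ring)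
  have hconst : ∀ T ∈ Ioi (0 : ℝ), Φ T = Φ 1 := fun T hT =>
    isOpen_Ioi.is_const_of_deriv_eq_zero isPreconnected_Ioi
      (fun x hx => (hΦd x hx).differentiableAt.differentiableWithinAt)
      (fun x hx => (hΦd x hx).deriv) hT (mem_Ioi.2 one_pos)
  have hΦ0 : Tendsto Φ (𝓝[>] 0) (𝓝 (Real.pi / 2)) := by
    have h1 := ((hd 0).continuousAt.tendsto).mono_left (nhdsWithin_le_nhds (s := Ioi 0))
    simpa using h1.add tendsto_integral_sineIntegrand_zero
  have hΦ1 : Φ 1 = Real.pi / 2 := by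
    refine tendsto_nhds_unique (tendsto_const_nhds.congr' ?_) hΦ0
    filter_upwards [self_mem_nhdsWithin] with T hT
    exact (hconst T hT).symm
  have hG : Tendsto (fun T => ∫ y in Ioi (0 : ℝ), sineIntegrand T y) atTop (𝓝 0) := by
    refine squeeze_zero_norm' (a := fun T => 2 / T) ?_ (tendsto_id.const_div_atTop 2)
    filter_upwards [eventually_gt_atTop 0] with T hT
    refine (norm_integral_le_of_norm_le
      ((integrableOn_exp_mul_Ioi (neg_lt_zero.2 hT) 0).const_mul 2) ?_).trans_eq ?_
    · filter_upwards [ae_restrict_mem measurableSet_Ioi] with y hy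
      exact abs_sineIntegrand_le T hy
    · rw [integral_const_mul, integral_exp_mul_Ioi (neg_lt_zero.2 hT)]
      simp
      ring
  have := hG.const_sub (Real.pi / 2)
  rw [sub_zero] at this
  refine this.congr' ?_
  filter_upwards [eventually_gt_atTop 0] with T hT
  rw [← hΦ1, ← hconst T hT]
  simp [hΦ]

/-! ### The Airy kernel and its numerator. -/

/-- The numerator of the Airy kernel, a solution `f` of `f'' = -(b + s) f + Ai(-(b + s)) Ai(-b)`. -/
noncomputable def airyKernelNum (b s : ℝ) : ℝ :=
  airyAi (-(b + s)) * -deriv airyAi (-b) - -deriv airyAi (-(b + s)) * airyAi (-b)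

/-- The derivative of `airyKernelNum b`. -/
noncomputable def airyKernelNumDeriv (b s : ℝ) : ℝ :=
  -deriv airyAi (-(b + s)) * -deriv airyAi (-b) + (b + s) * airyAi (-(b + s)) * airyAi (-b)

lemma hasDerivAt_airyKernelNum (b s : ℝ) :
    HasDerivAt (airyKernelNum b) (airyKernelNumDeriv b s) s := by
  have h1 := (hasDerivAt_airyAi_neg (b + s)).comp_const_add b s
  have h2 := (hasDerivAt_neg_deriv_airyAi_neg (b + s)).comp_const_add b s
  refine ((h1.mul_const (-deriv airyAi (-b))).sub (h2.mul_const (airyAi (-b)))).congr_deriv ?_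
  simp only [airyKernelNumDeriv]; ring

lemma hasDerivAt_airyKernelNumDeriv (b s : ℝ) :
    HasDerivAt (airyKernelNumDeriv b)
      (-((b + s) * airyKernelNum b s) + airyAi (-(b + s)) * airyAi (-b)) s := by
  have h1 := (hasDerivAt_airyAi_neg (b + s)).comp_const_add b s
  have h2 := (hasDerivAt_neg_deriv_airyAi_neg (b + s)).comp_const_add b s
  refine ((h2.mul_const (-deriv airyAi (-b))).add
    ((((hasDerivAt_id s).const_add b).mul h1).mul_const (airyAi (-b)))).congr_deriv ?_
  simp only [airyKernelNum, id]; ring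

lemma airyKernelNum_zero (b : ℝ) : airyKernelNum b 0 = 0 := by
  simp only [airyKernelNum, add_zero]; ring

/-- The initial slope of the numerator is where the energy, and with it the constant `1 / π`,
enters. -/
lemma airyKernelNumDeriv_zero {b : ℝ} (hb : 0 < b) :
    airyKernelNumDeriv b 0 = √b * airyAiEnergy b := by
  have hq := Real.sqrt_pos.2 hb
  simp only [airyKernelNumDeriv, airyAiEnergy, airyEnergy, add_zero]
  nth_rewrite 3 [← Real.sq_sqrt hb.le]
  generalize √b = q at *
  generalize deriv airyAi (-b) = v
  generalize airyAi (-b) = u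
  field_simp

lemma continuous_airyKernelNum (b : ℝ) : Continuous (airyKernelNum b) :=
  continuous_iff_continuousAt.2 fun s => (hasDerivAt_airyKernelNum b s).continuousAt

lemma continuous_airyKernelNumDeriv (b : ℝ) : Continuous (airyKernelNumDeriv b) :=
  continuous_iff_continuousAt.2 fun s => (hasDerivAt_airyKernelNumDeriv b s).continuousAt

lemma one_add_abs_rpow_le (x y : ℝ) {p : ℝ} (hp : 0 ≤ p) :
    (1 + |x|) ^ p ≤ (1 + |y|) ^ p * (1 + |x - y|) ^ p := by
  rw [← Real.mul_rpow (by positivity) (by positivity)]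
  refine Real.rpow_le_rpow (by positivity) ?_ hp
  have : |x| ≤ |y| + |x - y| := by
    calc |x| = |y + (x - y)| := by ring_nf
      _ ≤ _ := abs_add_le _ _
  nlinarith [abs_nonneg y, abs_nonneg (x - y)]

/-- A bound for `airyKernelNum` and for the forcing term of its equation, uniform in `b`. -/
lemma exists_abs_airyKernelNum_le :
    ∃ C > 0, ∀ b s, |airyKernelNum b s| ≤ C * (1 + |s|) ^ (1 / 4 : ℝ) ∧
      |airyAi (-(b + s)) * airyAi (-b)| ≤ C := by
  obtain ⟨C, hC0, hC⟩ := exists_airyAi_bounds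
  obtain ⟨D, hD0, hD⟩ := exists_abs_airyAi_le
  refine ⟨2 * C ^ 2 + D ^ 2, by positivity, fun b s => ⟨?_, ?_⟩⟩
  swap
  · rw [abs_mul]
    nlinarith [mul_le_mul (hD (-(b + s))) (hD (-b)) (abs_nonneg _) hD0.le, sq_nonneg C]
  -- The decay of `Ai` and the growth of `Ai'` have opposite exponents, so only the distance of the
  -- two arguments remains. This makes the bound uniform in `b`.
  have key : ∀ x y, |airyAi x * deriv airyAi y| ≤ C ^ 2 * (1 + |y - x|) ^ (1 / 4 : ℝ) := by
    intro x y
    have hQ : 0 < (1 + |x|) ^ (1 / 4 : ℝ) := by positivity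
    rw [abs_mul]
    calc |airyAi x| * |deriv airyAi y|
        ≤ |airyAi x| * (C * ((1 + |x|) ^ (1 / 4 : ℝ) * (1 + |y - x|) ^ (1 / 4 : ℝ))) := by
          gcongr
          exact (hC y).2.trans (by gcongr; exact one_add_abs_rpow_le y x (by norm_num))
      _ = C * (|airyAi x| * (1 + |x|) ^ (1 / 4 : ℝ)) * (1 + |y - x|) ^ (1 / 4 : ℝ) := by ring
      _ ≤ C * C * (1 + |y - x|) ^ (1 / 4 : ℝ) := by gcongr; exact (hC x).1
      _ = _ := by ring
  have h1 := key (-(b + s)) (-b)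
  have h2 := key (-b) (-(b + s))
  rw [show -b - -(b + s) = s by ring] at h1
  rw [show -(b + s) - -b = -s by ring, abs_neg] at h2
  calc |airyKernelNum b s|
      = |airyAi (-b) * deriv airyAi (-(b + s)) - airyAi (-(b + s)) * deriv airyAi (-b)| := by
        simp only [airyKernelNum]; ring_nf
    _ ≤ _ := abs_sub _ _
    _ ≤ 2 * C ^ 2 * (1 + |s|) ^ (1 / 4 : ℝ) := by linarith
    _ ≤ _ := by gcongr; linarith [sq_nonneg D]

lemma integrableOn_airyAi_mul_airyAi (R x a : ℝ) :
    IntegrableOn (fun t : ℝ => airyAi (t - x) * airyAi (t - a)) (Ioi (-R)) := by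
  obtain ⟨C, hC0, hC⟩ := exists_abs_airyAi_le
  obtain ⟨D, hD0, hD⟩ := exists_abs_airyAi_le_exp
  have hc : ∀ x, Continuous fun t => airyAi (t - x) := fun x =>
    continuous_airyAi.comp (by fun_prop)
  refine ((integrableOn_exp_mul_Ioi (a := -1) (by norm_num) (-R)).const_mul
    (C * (D * Real.exp a))).mono' ((hc x).mul (hc a)).aestronglyMeasurable
    (Eventually.of_forall fun t => ?_)
  rw [norm_mul]
  calc _ ≤ C * (D * Real.exp (-(t - a))) := by
        gcongr
        · exact hC _
        · exact (hD _).1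
    _ = _ := by rw [show -(t - a) = a + -1 * t by ring, Real.exp_add]; ring

/-- The Christoffel–Darboux type formula for the Airy kernel. -/
lemma sub_mul_integral_airyAi_mul_airyAi (R x a : ℝ) :
    (x - a) * ∫ t in Ioi (-R), airyAi (t - x) * airyAi (t - a) =
      airyKernelNum (R + a) (x - a) := by
  obtain ⟨D, hD0, hD⟩ := exists_abs_airyAi_le_exp
  have hd : ∀ t ∈ Ici (-R), HasDerivAt
      (fun t => airyAi (t - x) * deriv airyAi (t - a) - deriv airyAi (t - x) * airyAi (t - a))
      ((x - a) * (airyAi (t - x) * airyAi (t - a))) t := by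
    intro t _
    have h1 := fun y => (hasDerivAt_airyAi (t - y)).comp_sub_const t y
    have h2 := fun y => (hasDerivAt_deriv_airyAi (t - y)).comp_sub_const t y
    refine (((h1 x).mul (h2 a)).sub ((h2 x).mul (h1 a))).congr_deriv ?_
    ring
  have ht : Tendsto
      (fun t => airyAi (t - x) * deriv airyAi (t - a) - deriv airyAi (t - x) * airyAi (t - a))
      atTop (𝓝 0) := by
    have he : ∀ y, Tendsto (fun t : ℝ => D * Real.exp (-(t - y))) atTop (𝓝 0) := by
      intro y
      have : Tendsto (fun t : ℝ => -(t - y)) atTop atBot :=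
        tendsto_neg_atTop_atBot.comp (tendsto_atTop_add_const_right _ (-y) tendsto_id)
      simpa using (Real.tendsto_exp_atBot.comp this).const_mul D
    have h1 : ∀ y, Tendsto (fun t => airyAi (t - y)) atTop (𝓝 0) := fun y =>
      squeeze_zero_norm (fun t => (hD (t - y)).1) (he y)
    have h2 : ∀ y, Tendsto (fun t => deriv airyAi (t - y)) atTop (𝓝 0) := fun y =>
      squeeze_zero_norm (fun t => (hD (t - y)).2) (he y)
    simpa using ((h1 x).mul (h2 a)).sub ((h2 x).mul (h1 a))
  rw [← integral_const_mul, integral_Ioi_of_hasDerivAt_of_tendsto' hd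
    ((integrableOn_airyAi_mul_airyAi R x a).const_mul _) ht, airyKernelNum,
    show -(R + a + (x - a)) = -R - x by ring, show -(R + a) = -R - a by ring]
  ring

/-! ### The Riemann–Lebesgue argument. -/

/-- Integration by parts against a test function gains a factor `1 / b`. -/
lemma tendsto_integral_mul_airyKernelNum_of_contDiff {k : ℝ → ℝ} (hk : ContDiff ℝ 2 k)
    (hks : HasCompactSupport k) :
    Tendsto (fun b => ∫ s, k s * airyKernelNum b s) atTop (𝓝 0) := by
  obtain ⟨C, hC0, hC⟩ := exists_abs_airyKernelNum_le
  have hk1 : ∀ s, HasDerivAt k (deriv k s) s := fun s =>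
    (hk.differentiable (by norm_num) s).hasDerivAt
  have hdk : ContDiff ℝ 1 (deriv k) := hk.deriv' (n := 1)
  have hk2 : ∀ s, HasDerivAt (deriv k) (deriv (deriv k) s) s := fun s =>
    (hdk.differentiable (by norm_num) s).hasDerivAt
  have hddk : Continuous (deriv (deriv k)) := hdk.continuous_deriv le_rfl
  have hks1 : HasCompactSupport (deriv k) := hks.deriv
  have hks2 : HasCompactSupport (deriv (deriv k)) := hks1.deriv
  have hint : ∀ {g f : ℝ → ℝ}, Continuous g → HasCompactSupport g → Continuous f →
      Integrable (fun s => g s * f s) := fun hg hgs hf =>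
    (hg.mul hf).integrable_of_hasCompactSupport hgs.mul_right
  have hf := continuous_airyKernelNum
  have hf' := continuous_airyKernelNumDeriv
  have he : ∀ b, Continuous fun s => airyAi (-(b + s)) * airyAi (-b) := fun b =>
    (continuous_airyAi.comp (by fun_prop)).mul continuous_const
  have hf'' : ∀ b, Continuous fun s =>
      -((b + s) * airyKernelNum b s) + airyAi (-(b + s)) * airyAi (-b) := fun b =>
    ((continuous_const.add continuous_id).mul (hf b)).neg.add (he b)
  -- The equation for `f''` is solved for `b f`, and both derivatives are moved onto `k`. The
  -- right-hand side is bounded uniformly in `b`.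
  have hid : ∀ b, b * ∫ s, k s * airyKernelNum b s =
      ∫ s, (k s * (airyAi (-(b + s)) * airyAi (-b)) -
        (deriv (deriv k) s + k s * s) * airyKernelNum b s) := by
    intro b
    have e1 := integral_mul_deriv_eq_deriv_mul_of_integrable (fun s _ => hk1 s)
      (fun s _ => hasDerivAt_airyKernelNumDeriv b s) (hint hk.continuous hks (hf'' b))
      (hint hdk.continuous hks1 (hf' b)) (hint hk.continuous hks (hf' b))
    have e2 := integral_mul_deriv_eq_deriv_mul_of_integrable (fun s _ => hk2 s)
      (fun s _ => hasDerivAt_airyKernelNum b s) (hint hdk.continuous hks1 (hf' b))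
      (hint hddk hks2 (hf b)) (hint hdk.continuous hks1 (hf b))
    rw [e2, neg_neg] at e1
    have i0 := hint hk.continuous hks (he b)
    have i1 := hint (hddk.add (hk.continuous.mul continuous_id)) (hks2.add hks.mul_right) (hf b)
    have i2 := (hint hk.continuous hks (hf b)).const_mul b
    have i3 := hint hk.continuous hks (hf'' b)
    have i4 := hint hddk hks2 (hf b)
    have i5 : Integrable (fun s => k s * (airyAi (-(b + s)) * airyAi (-b)) -
        (deriv (deriv k) s + k s * s) * airyKernelNum b s) := i0.sub i1
    have key : (∫ s, (k s * (airyAi (-(b + s)) * airyAi (-b)) -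
        (deriv (deriv k) s + k s * s) * airyKernelNum b s)) - b * ∫ s, k s * airyKernelNum b s =
        (∫ s, k s * (-((b + s) * airyKernelNum b s) + airyAi (-(b + s)) * airyAi (-b))) -
          ∫ s, deriv (deriv k) s * airyKernelNum b s := by
      rw [← integral_const_mul, ← integral_sub i5 i2, ← integral_sub i3 i4]
      congr 1; ext s; ring
    rw [e1, sub_self, sub_eq_zero] at key
    exact key.symm
  set M := ∫ s, (|k s| * C + |deriv (deriv k) s + k s * s| * (C * (1 + |s|) ^ (1 / 4 : ℝ)))
    with hM
  have hMi : Integrable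
      (fun s => |k s| * C + |deriv (deriv k) s + k s * s| * (C * (1 + |s|) ^ (1 / 4 : ℝ))) := by
    refine ((hk.continuous.integrable_of_hasCompactSupport hks).abs.mul_const C).add
      (Continuous.integrable_of_hasCompactSupport ?_ ?_)
    · refine (hddk.add (hk.continuous.mul continuous_id)).abs.mul (continuous_const.mul ?_)
      exact (by fun_prop : Continuous fun s : ℝ => 1 + |s|).rpow_const fun s =>
        Or.inr (by norm_num)
    · exact (hks2.add hks.mul_right).norm.mul_right
  refine squeeze_zero_norm' (a := fun b => M / b) ?_ (tendsto_id.const_div_atTop M)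
  filter_upwards [eventually_gt_atTop 0] with b hb
  rw [le_div_iff₀ hb, mul_comm, ← Real.norm_of_nonneg hb.le, ← norm_mul, Real.norm_of_nonneg hb.le,
    hid]
  refine norm_integral_le_of_norm_le hMi (Eventually.of_forall fun s => (norm_sub_le _ _).trans ?_)
  rw [norm_mul (k s), norm_mul (_ + _)]
  exact add_le_add (mul_le_mul_of_nonneg_left (hC b s).2 (abs_nonneg _))
    (mul_le_mul_of_nonneg_left (hC b s).1 (abs_nonneg _))

lemma integrable_mul_airyKernelNum {h : ℝ → ℝ}
    (hh : Integrable fun s => h s * (1 + |s|) ^ (1 / 4 : ℝ)) (b : ℝ) :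
    Integrable fun s => h s * airyKernelNum b s := by
  obtain ⟨C, -, hC⟩ := exists_abs_airyKernelNum_le
  have hq : ∀ s : ℝ, 0 < (1 + |s|) ^ (1 / 4 : ℝ) := fun s => by positivity
  have hqc : Continuous fun s : ℝ => (1 + |s|) ^ (1 / 4 : ℝ) :=
    (by fun_prop : Continuous fun s : ℝ => 1 + |s|).rpow_const fun s => Or.inr (by norm_num)
  refine (hh.bdd_mul (c := C) (f := fun s => airyKernelNum b s / (1 + |s|) ^ (1 / 4 : ℝ))
    ((continuous_airyKernelNum b).div hqc fun s => (hq s).ne').aestronglyMeasurable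
    (Eventually.of_forall fun s => ?_)).congr (Eventually.of_forall fun s => ?_)
  · rw [norm_div, Real.norm_of_nonneg (hq s).le, div_le_iff₀ (hq s)]
    exact (hC b s).1
  · have := (hq s).ne'
    field_simp

open scoped ContDiff in
/-- A Riemann–Lebesgue lemma for the numerator of the Airy kernel. -/
lemma tendsto_integral_mul_airyKernelNum {h : ℝ → ℝ}
    (hh : Integrable fun s => h s * (1 + |s|) ^ (1 / 4 : ℝ)) :
    Tendsto (fun b => ∫ s, h s * airyKernelNum b s) atTop (𝓝 0) := by
  obtain ⟨C, hC0, hC⟩ := exists_abs_airyKernelNum_le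
  have hp : ∀ s : ℝ, 0 < 1 + s ^ 2 := fun s => by positivity
  have hsmooth : ∀ p : ℝ, ContDiff ℝ 2 fun s : ℝ => (1 + s ^ 2) ^ p := fun p =>
    (by fun_prop : ContDiff ℝ 2 fun s : ℝ => 1 + s ^ 2).rpow_const_of_ne fun s => (hp s).ne'
  have hq : ∀ s : ℝ, 0 < (1 + |s|) ^ (1 / 4 : ℝ) := fun s => by positivity
  have hqw : ∀ s : ℝ, (1 + |s|) ^ (1 / 4 : ℝ) = ((1 + |s|) ^ 2) ^ (1 / 8 : ℝ) := fun s => by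
    rw [← Real.rpow_natCast, ← Real.rpow_mul (by positivity)]; norm_num
  have hle : ∀ s : ℝ, (1 + s ^ 2) ^ (1 / 8 : ℝ) ≤ (1 + |s|) ^ (1 / 4 : ℝ) := fun s => by
    rw [hqw]
    refine Real.rpow_le_rpow (hp s).le ?_ (by norm_num)
    nlinarith [abs_nonneg s, sq_abs s]
  have hge : ∀ s : ℝ, (1 + |s|) ^ (1 / 4 : ℝ) ≤ 2 * (1 + s ^ 2) ^ (1 / 8 : ℝ) := fun s => by
    calc _ ≤ (2 * (1 + s ^ 2)) ^ (1 / 8 : ℝ) := by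
          rw [hqw]
          refine Real.rpow_le_rpow (by positivity) ?_ (by norm_num)
          nlinarith [sq_nonneg (1 - |s|), sq_abs s]
      _ ≤ _ := by
          rw [Real.mul_rpow two_pos.le (hp s).le]
          gcongr
          exact Real.rpow_le_self_of_one_le one_le_two (by norm_num)
  have hqc : Continuous fun s : ℝ => (1 + |s|) ^ (1 / 4 : ℝ) :=
    (by fun_prop : Continuous fun s : ℝ => 1 + |s|).rpow_const fun s => Or.inr (by norm_num)
  have hH : Integrable fun s => h s * (1 + s ^ 2) ^ (1 / 8 : ℝ) := by
    refine (hh.bdd_mul (c := 1) (f := fun s => (1 + s ^ 2) ^ (1 / 8 : ℝ) / (1 + |s|) ^ (1 / 4 : ℝ))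
      ((hsmooth _).continuous.div hqc fun s => (hq s).ne').aestronglyMeasurable
      (Eventually.of_forall fun s => ?_)).congr (Eventually.of_forall fun s => ?_)
    · rw [norm_div, Real.norm_of_nonneg (hq s).le, Real.norm_of_nonneg (by positivity)]
      exact div_le_one_of_le₀ (hle s) (hq s).le
    · have := (hq s).ne'
      field_simp
  rw [NormedAddGroup.tendsto_nhds_zero]
  intro ε hε
  -- Approximation in weighted `L¹`. The weight `(1 + s²)^{1/8}`, comparable to `(1 + |s|)^{1/4}`,
  -- is smooth, so dividing `g` by it preserves regularity. The tolerance meets the factor `2 C`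
  -- below and yields `ε / 4`.
  obtain ⟨g, hgs, hg, hgε⟩ := MemLp.exist_eLpNorm_sub_le ENNReal.one_ne_top le_rfl
    (memLp_one_iff_integrable.2 hH) (ε := ε / (8 * C)) (by positivity)
  have hgi : Integrable g := hg.continuous.integrable_of_hasCompactSupport hgs
  have hgε' : ∫ s, ‖h s * (1 + s ^ 2) ^ (1 / 8 : ℝ) - g s‖ ≤ ε / (8 * C) := by
    rw [eLpNorm_one_eq_lintegral_enorm, ← ofReal_integral_norm_eq_lintegral_enorm (hH.sub hgi),
      ENNReal.ofReal_le_ofReal_iff (by positivity)] at hgε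
    exact hgε
  set k : ℝ → ℝ := fun s => g s * (1 + s ^ 2) ^ (-(1 / 8) : ℝ) with hk
  have hks : HasCompactSupport k := hgs.mul_right
  have hkc : ContDiff ℝ 2 k := (contDiff_infty.1 hg 2).mul (hsmooth _)
  have hki : Integrable fun s => k s * (1 + |s|) ^ (1 / 4 : ℝ) :=
    (hkc.continuous.mul hqc).integrable_of_hasCompactSupport hks.mul_right
  have hev := (NormedAddGroup.tendsto_nhds_zero.1
    (tendsto_integral_mul_airyKernelNum_of_contDiff hkc hks)) (ε / 2) (half_pos hε)
  filter_upwards [hev] with b hb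
  have hdiff : ‖∫ s, (h s * airyKernelNum b s - k s * airyKernelNum b s)‖ ≤ ε / 4 := by
    refine (norm_integral_le_of_norm_le ((hH.sub hgi).norm.const_mul (2 * C))
      (Eventually.of_forall fun s => ?_)).trans ?_
    · rw [← sub_mul, norm_mul]
      have hw : 0 < (1 + s ^ 2) ^ (1 / 8 : ℝ) := Real.rpow_pos_of_pos (hp s) _
      calc ‖h s - k s‖ * ‖airyKernelNum b s‖
          ≤ ‖h s - k s‖ * (C * (2 * (1 + s ^ 2) ^ (1 / 8 : ℝ))) := by
            gcongr
            exact (hC b s).1.trans (by gcongr; exact hge s)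
        _ = 2 * C * (‖h s - k s‖ * ‖(1 + s ^ 2) ^ (1 / 8 : ℝ)‖) := by
            rw [Real.norm_of_nonneg hw.le]; ring
        _ = 2 * C * ‖h s * (1 + s ^ 2) ^ (1 / 8 : ℝ) - g s‖ := by
            have : k s * (1 + s ^ 2) ^ (1 / 8 : ℝ) = g s := by
              simp only [hk]
              rw [Real.rpow_neg (hp s).le, inv_mul_cancel_right₀ hw.ne']
            rw [← norm_mul, sub_mul, this]
    · rw [integral_const_mul]
      calc _ ≤ 2 * C * (ε / (8 * C)) := by gcongr; exact hgε'
        _ = ε / 4 := by field_simp; ring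
  rw [integral_sub (integrable_mul_airyKernelNum hh b) (integrable_mul_airyKernelNum hki b)] at hdiff
  have := norm_le_norm_sub_add (∫ s, h s * airyKernelNum b s) (∫ s, k s * airyKernelNum b s)
  linarith

/-! ### The mass of the kernel near its singularity. -/

/-- Comparison of `airyKernelNum b` with a sine wave. -/
lemma exists_abs_airyKernelNum_sub_sin_le : ∃ C > 0, ∀ b > 0, ∀ s, |s| ≤ 1 →
    |√b * airyKernelNum b s - √b * airyAiEnergy b * Real.sin (√b * s)| ≤ C * |s| := by
  obtain ⟨C, hC0, hC⟩ := exists_abs_airyKernelNum_le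
  refine ⟨3 * C, by positivity, fun b hb s hs => ?_⟩
  -- Variation of constants for `f'' + b f`: `P` takes the values `√b f(s)` at `r = s` and `f'(0)
  -- sin (√b s)` at `r = 0`, and its derivative contains no factor growing with `b`.
  set P : ℝ → ℝ := fun r => airyKernelNum b r * (√b * Real.cos (√b * (s - r))) +
    airyKernelNumDeriv b r * Real.sin (√b * (s - r)) with hP
  have hd : ∀ r, HasDerivAt P ((airyAi (-(b + r)) * airyAi (-b) - r * airyKernelNum b r) *
      Real.sin (√b * (s - r))) r := by
    intro r
    have h0 : HasDerivAt (fun r => √b * (s - r)) (√b * -1) r :=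
      ((hasDerivAt_id r).const_sub s).const_mul _
    refine (((hasDerivAt_airyKernelNum b r).mul (h0.cos.const_mul √b)).add
      ((hasDerivAt_airyKernelNumDeriv b r).mul h0.sin)).congr_deriv ?_
    linear_combination (airyKernelNum b r * Real.sin (√b * (s - r))) * Real.mul_self_sqrt hb.le
  have hbound : ∀ r ∈ uIcc 0 s, ‖(airyAi (-(b + r)) * airyAi (-b) - r * airyKernelNum b r) *
      Real.sin (√b * (s - r))‖ ≤ 3 * C := by
    intro r hr
    have hr1 : |r| ≤ 1 := by
      have : |r| ≤ |s| := by simpa using abs_sub_left_of_mem_uIcc hr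
      exact this.trans hs
    have h1 : |r * airyKernelNum b r| ≤ 1 * (C * 2) := by
      rw [abs_mul]
      gcongr
      refine (hC b r).1.trans ?_
      gcongr
      refine (Real.rpow_le_self_of_one_le (by linarith [abs_nonneg r]) (by norm_num)).trans ?_
      linarith
    rw [norm_mul]
    refine (mul_le_of_le_one_right (norm_nonneg _) (Real.abs_sin_le_one _)).trans ?_
    refine (norm_sub_le _ _).trans ?_
    simp only [Real.norm_eq_abs]
    linarith [(hC b r).2]
  have h := (convex_uIcc (0 : ℝ) s).norm_image_sub_le_of_norm_hasDerivWithin_le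
    (fun r _ => (hd r).hasDerivWithinAt) hbound left_mem_uIcc right_mem_uIcc
  have h1 : P s - P 0 = √b * airyKernelNum b s - √b * airyAiEnergy b * Real.sin (√b * s) := by
    simp only [hP, airyKernelNum_zero, airyKernelNumDeriv_zero hb]
    simp
    ring
  rw [h1] at h
  rwa [sub_zero] at h

/-- The Airy kernel `f(s) / s`, with its removable singularity removed. -/
noncomputable def airyKernel (b : ℝ) : ℝ → ℝ := dslope (airyKernelNum b) 0

lemma airyKernel_of_ne (b : ℝ) {s : ℝ} (hs : s ≠ 0) : airyKernel b s = airyKernelNum b s / s := by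
  rw [airyKernel, dslope_of_ne _ hs, slope_def_field, airyKernelNum_zero, sub_zero, sub_zero]

lemma continuous_airyKernel (b : ℝ) : Continuous (airyKernel b) := by
  rw [continuous_iff_continuousAt]
  intro s
  rcases eq_or_ne s 0 with rfl | hs
  · exact continuousAt_dslope_same.2 (hasDerivAt_airyKernelNum b 0).differentiableAt
  · exact (continuousAt_dslope_of_ne hs).2 (continuous_airyKernelNum b).continuousAt

/-- Over a unit interval on either side of the singularity, the Airy kernel integrates to `1 / 2`
in the limit. -/
lemma tendsto_integral_airyKernel (σ : ℝ) (hσ : |σ| = 1) :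
    Tendsto (fun b => ∫ s in (0 : ℝ)..1, airyKernel b (σ * s)) atTop (𝓝 (1 / 2)) := by
  obtain ⟨C, hC0, hC⟩ := exists_abs_airyKernelNum_sub_sin_le
  have hσ0 : σ ≠ 0 := by rintro rfl; simp at hσ
  have hmain : Tendsto (fun b => airyAiEnergy b * ∫ s in (0 : ℝ)..√b, Real.sinc s) atTop
      (𝓝 (1 / 2)) := by
    have := tendsto_airyAiEnergy.mul (tendsto_integral_sinc.comp Real.tendsto_sqrt_atTop)
    have hpi := Real.pi_ne_zero
    rwa [show 1 / Real.pi * (Real.pi / 2) = 1 / 2 by field_simp] at this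
  -- Dividing the sine comparison by `√b |s|` bounds the difference of the integrands by `C / √b`,
  -- uniformly on `(0, 1]`.
  have herr : Tendsto (fun b => (∫ s in (0 : ℝ)..1, airyKernel b (σ * s)) -
      airyAiEnergy b * ∫ s in (0 : ℝ)..√b, Real.sinc s) atTop (𝓝 0) := by
    refine squeeze_zero_norm' (a := fun b => C / √b) ?_
      (Real.tendsto_sqrt_atTop.const_div_atTop C)
    filter_upwards [eventually_gt_atTop 0] with b hb
    have hq := Real.sqrt_pos.2 hb
    have hsc : ∫ s in (0 : ℝ)..√b, Real.sinc s = ∫ s in (0 : ℝ)..1, √b * Real.sinc (√b * s) := by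
      rw [intervalIntegral.integral_const_mul, intervalIntegral.integral_comp_mul_left _ hq.ne']
      simp [hq.ne']
    have hc1 : Continuous fun s => airyKernel b (σ * s) :=
      (continuous_airyKernel b).comp (by fun_prop)
    have hc2 : Continuous fun s => airyAiEnergy b * (√b * Real.sinc (√b * s)) :=
      continuous_const.mul (continuous_const.mul (Real.continuous_sinc.comp (by fun_prop)))
    rw [hsc, ← intervalIntegral.integral_const_mul, ← intervalIntegral.integral_sub
      (hc1.intervalIntegrable _ _) (hc2.intervalIntegrable _ _)]
    refine (intervalIntegral.norm_integral_le_of_norm_le_const (C := C / √b) ?_).trans_eq (by simp)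
    intro s hs
    rw [uIoc_of_le zero_le_one] at hs
    have hs0 : s ≠ 0 := hs.1.ne'
    have h := hC b hb (σ * s) (by rw [abs_mul, hσ, one_mul, abs_of_pos hs.1]; exact hs.2)
    have hsin : Real.sin (√b * (σ * s)) = √b * (σ * s) * Real.sinc (√b * s) := by
      rw [Real.sinc_of_ne_zero (by positivity)]
      rcases eq_or_eq_neg_of_abs_eq hσ with rfl | rfl
      · field_simp
      · rw [show √b * (-1 * s) = -(√b * s) by ring, Real.sin_neg]; field_simp
    have heq : √b * airyKernelNum b (σ * s) - √b * airyAiEnergy b * Real.sin (√b * (σ * s)) =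
        √b * (σ * s) * (airyKernel b (σ * s) - airyAiEnergy b * (√b * Real.sinc (√b * s))) := by
      rw [airyKernel_of_ne b (mul_ne_zero hσ0 hs0), hsin]
      field_simp
    rw [heq, abs_mul, abs_mul, abs_mul, hσ, abs_of_pos hq, abs_of_pos hs.1] at h
    rw [le_div_iff₀ hq, Real.norm_eq_abs]
    have hs1 : 0 < s := hs.1
    exact le_of_mul_le_mul_left (by linarith) hs1
  simpa using herr.add hmain

/-! ### Piecewise `C¹` functions and the difference quotient at `a`. -/

lemma eventually_notMem_of_finite_inter_Icc {S : Set ℝ} (hS : ∀ A B : ℝ, (S ∩ Icc A B).Finite)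
    (a : ℝ) : ∀ᶠ x in 𝓝[≠] a, x ∉ S := by
  have h1 : ((S ∩ Icc (a - 1) (a + 1)) \ {a})ᶜ ∈ 𝓝 a :=
    ((hS _ _).subset sdiff_subset).isClosed.isOpen_compl.mem_nhds (by simp)
  have h2 : Icc (a - 1) (a + 1) ∈ 𝓝 a := Icc_mem_nhds (by linarith) (by linarith)
  filter_upwards [mem_nhdsWithin_of_mem_nhds h1, mem_nhdsWithin_of_mem_nhds h2,
    self_mem_nhdsWithin] with x hx1 hx2 hx3 hxS
  exact hx1 ⟨⟨hxS, hx2⟩, hx3⟩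

lemma IsPiecewiseC1.eventually_differentiableAt {φ : ℝ → ℝ} (hφ : IsPiecewiseC1 φ) (a : ℝ) :
    ∀ᶠ x in 𝓝[≠] a, DifferentiableAt ℝ φ x := by
  obtain ⟨S, hS, hd, -⟩ := hφ
  exact (eventually_notMem_of_finite_inter_Icc hS a).mono fun x hx => (hd x hx).1

lemma IsPiecewiseC1.tendsto_right {φ : ℝ → ℝ} (hφ : IsPiecewiseC1 φ) (a : ℝ) :
    ∃ r r', Tendsto φ (𝓝[>] a) (𝓝 r) ∧ Tendsto (deriv φ) (𝓝[>] a) (𝓝 r') := by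
  obtain ⟨S, -, hd, hs⟩ := hφ
  by_cases ha : a ∈ S
  · obtain ⟨-, ⟨r, hr⟩, -, ⟨r', hr'⟩⟩ := hs a ha
    exact ⟨r, r', hr, hr'⟩
  · exact ⟨_, _, ((hd a ha).1.continuousAt.tendsto).mono_left nhdsWithin_le_nhds,
      ((hd a ha).2.tendsto).mono_left nhdsWithin_le_nhds⟩

lemma IsPiecewiseC1.tendsto_left {φ : ℝ → ℝ} (hφ : IsPiecewiseC1 φ) (a : ℝ) :
    ∃ l l', Tendsto φ (𝓝[<] a) (𝓝 l) ∧ Tendsto (deriv φ) (𝓝[<] a) (𝓝 l') := by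
  obtain ⟨S, -, hd, hs⟩ := hφ
  by_cases ha : a ∈ S
  · obtain ⟨⟨l, hl⟩, -, ⟨l', hl'⟩, -⟩ := hs a ha
    exact ⟨l, l', hl, hl'⟩
  · exact ⟨_, _, ((hd a ha).1.continuousAt.tendsto).mono_left nhdsWithin_le_nhds,
      ((hd a ha).2.tendsto).mono_left nhdsWithin_le_nhds⟩

lemma IsPiecewiseC1.aestronglyMeasurable {φ : ℝ → ℝ} (hφ : IsPiecewiseC1 φ) :
    AEStronglyMeasurable φ volume := by
  obtain ⟨S, hS, hd, -⟩ := hφ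
  have hcount : S.Countable := by
    have : S = ⋃ n : ℕ, S ∩ Icc (-n : ℝ) n := by
      rw [← inter_iUnion, eq_comm, inter_eq_left]
      intro x _
      obtain ⟨n, hn⟩ := exists_nat_ge |x|
      exact mem_iUnion.2 ⟨n, abs_le.1 hn⟩
    rw [this]
    exact countable_iUnion fun n => (hS _ _).countable
  have hc : ContinuousOn φ Sᶜ := fun x hx => (hd x hx).1.continuousAt.continuousWithinAt
  have := hc.aestronglyMeasurable (μ := volume) hcount.measurableSet.compl
  have hae : ∀ᵐ x ∂(volume : Measure ℝ), x ∈ Sᶜ := hcount.ae_notMem volume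
  rwa [Measure.restrict_eq_self_of_ae_mem hae] at this

lemma IsPiecewiseC1.locallyIntegrable {φ : ℝ → ℝ} (hφ : IsPiecewiseC1 φ) :
    LocallyIntegrable φ := by
  intro x
  obtain ⟨r, -, hr, -⟩ := hφ.tendsto_right x
  obtain ⟨l, -, hl, -⟩ := hφ.tendsto_left x
  have hm : ∀ f : Filter ℝ, StronglyMeasurableAtFilter φ f := fun f =>
    hφ.aestronglyMeasurable.stronglyMeasurableAtFilter
  obtain ⟨s, hs, hsi⟩ := hr.integrableAtFilter (hm _)
    ((volume.finiteAt_nhds x).filter_mono nhdsWithin_le_nhds)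
  obtain ⟨t, ht, hti⟩ := hl.integrableAtFilter (hm _)
    ((volume.finiteAt_nhds x).filter_mono nhdsWithin_le_nhds)
  refine ⟨t ∪ s ∪ {x}, ?_, (hti.union hsi).union (by simp)⟩
  rw [← nhdsNE_sup_pure, ← nhdsLT_sup_nhdsGT]
  exact ⟨⟨mem_of_superset ht (by intro y hy; simp [hy]),
    mem_of_superset hs (by intro y hy; simp [hy])⟩, by simp⟩

lemma continuous_one_add_abs_rpow (p : ℝ) : Continuous fun x : ℝ => (1 + |x|) ^ p :=
  (by fun_prop : Continuous fun x : ℝ => 1 + |x|).rpow_const fun x =>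
    Or.inl (by positivity : (0 : ℝ) < 1 + |x|).ne'

/-- Merges the two hypotheses into one with a weight that is continuous at `0` and changes only by a
constant factor under translation by `a`. Local integrability covers `[-1, 1]`. -/
lemma IsPiecewiseC1.integrable_mul_weight {φ : ℝ → ℝ} (hφ : IsPiecewiseC1 φ)
    (hneg : IntegrableOn (fun x : ℝ => |x| ^ (-(3 / 4) : ℝ) * |φ x|) (Iic (-1)))
    (hpos : IntegrableOn (fun x : ℝ => x ^ (-(3 / 4) : ℝ) * |φ x|) (Ici 1)) :
    Integrable fun x => φ x * (1 + |x|) ^ (-(3 / 4) : ℝ) := by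
  have hm : AEStronglyMeasurable (fun x => φ x * (1 + |x|) ^ (-(3 / 4) : ℝ)) volume :=
    hφ.aestronglyMeasurable.mul (continuous_one_add_abs_rpow _).aestronglyMeasurable
  have hle : ∀ x : ℝ, 0 < |x| →
      ‖φ x * (1 + |x|) ^ (-(3 / 4) : ℝ)‖ ≤ |x| ^ (-(3 / 4) : ℝ) * |φ x| := by
    intro x hx
    rw [norm_mul, Real.norm_of_nonneg (by positivity : 0 ≤ (1 + |x|) ^ (-(3 / 4) : ℝ)), mul_comm,
      Real.norm_eq_abs]
    refine mul_le_mul_of_nonneg_right ?_ (abs_nonneg _)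
    exact Real.rpow_le_rpow_of_nonpos hx (by linarith) (by norm_num)
  rw [← integrableOn_univ, ← Iic_union_Ici (a := (-1 : ℝ)),
    ← Icc_union_Ici_eq_Ici (by norm_num : (-1 : ℝ) ≤ 1)]
  refine IntegrableOn.union (hneg.mono' hm.restrict ?_)
    (IntegrableOn.union ?_ (hpos.mono' hm.restrict ?_))
  · filter_upwards [ae_restrict_mem measurableSet_Iic] with x (hx : x ≤ -1)
    exact hle x (abs_pos.2 (by linarith))
  · exact (hφ.locallyIntegrable.integrableOn_isCompact isCompact_Icc).mul_continuousOn
      (continuous_one_add_abs_rpow _).continuousOn isCompact_Icc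
  · filter_upwards [ae_restrict_mem measurableSet_Ici] with x (hx : 1 ≤ x)
    have := hle x (abs_pos.2 (by linarith))
    simpa only [abs_of_pos (by linarith : 0 < x)] using this

/-- The value `ψ a` is arbitrary, so the mean value inequality is applied between two points to the
right of `a`, and one of them then tends to `a`. -/
lemma exists_abs_sub_le_of_tendsto_deriv {ψ : ℝ → ℝ} {a r r' : ℝ}
    (hd : ∀ᶠ x in 𝓝[>] a, DifferentiableAt ℝ ψ x) (hr : Tendsto ψ (𝓝[>] a) (𝓝 r))
    (hr' : Tendsto (deriv ψ) (𝓝[>] a) (𝓝 r')) :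
    ∃ δ > 0, ∃ M, ∀ s ∈ Ioo 0 δ, |ψ (a + s) - r| ≤ M * s := by
  have hb : ∀ᶠ x in 𝓝[>] a, ‖deriv ψ x‖ ≤ ‖r'‖ + 1 :=
    (hr'.norm.eventually_lt_const (lt_add_one _)).mono fun x hx => hx.le
  obtain ⟨u, hu, hsub⟩ := mem_nhdsGT_iff_exists_Ioo_subset.1 (hd.and hb)
  refine ⟨u - a, sub_pos.2 hu, ‖r'‖ + 1, fun s hs => ?_⟩
  have hle : ∀ᶠ x in 𝓝[>] a, |ψ (a + s) - ψ x| ≤ (‖r'‖ + 1) * |a + s - x| := by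
    filter_upwards [Ioo_mem_nhdsGT (show a < a + s by linarith [hs.1])] with x hx
    refine (convex_Ioo a u).norm_image_sub_le_of_norm_deriv_le (fun y hy => (hsub hy).1)
      (fun y hy => (hsub hy).2) ⟨hx.1, ?_⟩ ⟨?_, ?_⟩ <;> linarith [hs.1, hs.2, hx.2]
  have hlim : Tendsto (fun x => (‖r'‖ + 1) * |a + s - x|) (𝓝[>] a)
      (𝓝 ((‖r'‖ + 1) * |a + s - a|)) :=
    ((by fun_prop : Continuous fun x => (‖r'‖ + 1) * |a + s - x|).tendsto a).mono_left
      nhdsWithin_le_nhds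
  have := le_of_tendsto_of_tendsto (hr.const_sub (ψ (a + s))).abs hlim hle
  rwa [add_sub_cancel_left, abs_of_pos hs.1] at this

lemma IsPiecewiseC1.exists_abs_sub_le_right {φ : ℝ → ℝ} (hφ : IsPiecewiseC1 φ) {a r : ℝ}
    (hr : Tendsto φ (𝓝[>] a) (𝓝 r)) : ∃ δ > 0, ∃ M, ∀ s ∈ Ioo 0 δ, |φ (a + s) - r| ≤ M * s := by
  obtain ⟨-, r', -, hr'⟩ := hφ.tendsto_right a
  exact exists_abs_sub_le_of_tendsto_deriv
    ((hφ.eventually_differentiableAt a).filter_mono (nhdsWithin_mono _ fun _ h => ne_of_gt h)) hr hr'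

lemma IsPiecewiseC1.exists_abs_sub_le_left {φ : ℝ → ℝ} (hφ : IsPiecewiseC1 φ) {a l : ℝ}
    (hl : Tendsto φ (𝓝[<] a) (𝓝 l)) : ∃ δ > 0, ∃ M, ∀ s ∈ Ioo 0 δ, |φ (a - s) - l| ≤ M * s := by
  obtain ⟨-, l', -, hl'⟩ := hφ.tendsto_left a
  have hn : Tendsto (fun x : ℝ => -x) (𝓝[>] (-a)) (𝓝[<] a) := by
    simpa using tendsto_neg_nhdsGT (a := -a)
  have hd := hn.eventually ((hφ.eventually_differentiableAt a).filter_mono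
    (nhdsWithin_mono _ fun _ h => ne_of_lt h))
  obtain ⟨δ, hδ, M, hM⟩ := exists_abs_sub_le_of_tendsto_deriv (ψ := fun x => φ (-x)) (r' := -l')
    (hd.mono fun x hx => hx.comp x (hasDerivAt_neg x).differentiableAt)
    (hl.comp hn) ((hl'.comp hn).neg.congr fun x => by simp [deriv_comp_neg])
  refine ⟨δ, hδ, M, fun s hs => ?_⟩
  have := hM s hs
  rwa [show -(-a + s) = a - s by ring] at this

/-- The step function with value `r` on `(0, 1]` and `l` on `(-1, 0]`. -/
noncomputable def unitStep (l r : ℝ) : ℝ → ℝ :=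
  (Ioc (0 : ℝ) 1).indicator (fun _ => r) + (Ioc (-1 : ℝ) 0).indicator (fun _ => l)

lemma integrable_unitStep (l r : ℝ) : Integrable (unitStep l r) := by
  refine Integrable.add ?_ ?_
  · exact (integrable_indicator_iff measurableSet_Ioc).2 (by simp)
  · exact (integrable_indicator_iff measurableSet_Ioc).2 (by simp)

lemma unitStep_of_pos (l r : ℝ) {s : ℝ} (h0 : 0 < s) (h1 : s ≤ 1) : unitStep l r s = r := by
  simp [unitStep, h0, h1, h0.not_ge]

lemma unitStep_of_neg (l r : ℝ) {s : ℝ} (h0 : s < 0) (h1 : -1 < s) : unitStep l r s = l := by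
  simp [unitStep, h0.le, h1, h0.not_gt]

/-- The difference quotient of `φ` at `a`, with the one-sided limits subtracted on a unit
neighbourhood, is integrable against the growth of the Airy kernel numerator. -/
lemma integrable_sub_unitStep_div {φ : ℝ → ℝ} (hφ : IsPiecewiseC1 φ) {a l r : ℝ}
    (hw : Integrable fun x => φ x * (1 + |x|) ^ (-(3 / 4) : ℝ))
    (hl : Tendsto φ (𝓝[<] a) (𝓝 l)) (hr : Tendsto φ (𝓝[>] a) (𝓝 r)) :
    Integrable fun s => (φ (a + s) - unitStep l r s) / s * (1 + |s|) ^ (1 / 4 : ℝ) := by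
  obtain ⟨δ₁, hδ₁, M₁, hM₁⟩ := hφ.exists_abs_sub_le_right hr
  obtain ⟨δ₂, hδ₂, M₂, hM₂⟩ := hφ.exists_abs_sub_le_left hl
  obtain ⟨δ, hδ, hδ1, hδδ₁, hδδ₂⟩ : ∃ δ > 0, δ ≤ 1 ∧ δ ≤ δ₁ ∧ δ ≤ δ₂ :=
    ⟨min 1 (min δ₁ δ₂), by positivity, min_le_left _ _, (min_le_right _ _).trans (min_le_left _ _),
      (min_le_right _ _).trans (min_le_right _ _)⟩
  have hmeas : AEStronglyMeasurable
      (fun s => (φ (a + s) - unitStep l r s) / s * (1 + |s|) ^ (1 / 4 : ℝ)) volume := by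
    have h1 : AEStronglyMeasurable (fun s => φ (a + s)) volume :=
      hφ.aestronglyMeasurable.comp_quasiMeasurePreserving
        (measurePreserving_add_left volume a).quasiMeasurePreserving
    simp_rw [div_eq_mul_inv]
    exact ((h1.sub (integrable_unitStep l r).aestronglyMeasurable).mul
      measurable_inv.aestronglyMeasurable).mul
      (continuous_one_add_abs_rpow _).aestronglyMeasurable
  rw [← integrableOn_univ, ← union_compl_self (Ioo (-δ) δ)]
  refine IntegrableOn.union ?_ ?_
  · refine Measure.integrableOn_of_bounded (M := (|M₁| + |M₂|) * 2) (by simp) hmeas ?_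
    have hne : ∀ᵐ s : ℝ ∂(volume.restrict (Ioo (-δ) δ)), s ≠ 0 :=
      ae_restrict_of_ae (Measure.ae_ne volume 0)
    filter_upwards [ae_restrict_mem measurableSet_Ioo, hne] with s hs hs0
    have hs1 : |s| ≤ 1 := abs_le.2 ⟨by linarith [hs.1], by linarith [hs.2]⟩
    have hquot : |φ (a + s) - unitStep l r s| ≤ (|M₁| + |M₂|) * |s| := by
      rcases lt_or_gt_of_ne hs0 with h | h
      · rw [unitStep_of_neg l r h (by linarith [hs.1])]
        have := hM₂ (-s) ⟨by linarith, by linarith [hs.1]⟩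
        rw [sub_neg_eq_add] at this
        rw [abs_of_neg h]
        nlinarith [le_abs_self M₂, abs_nonneg M₁]
      · rw [unitStep_of_pos l r h (by linarith [hs.2])]
        have := hM₁ s ⟨h, by linarith [hs.2]⟩
        rw [abs_of_pos h]
        nlinarith [le_abs_self M₁, abs_nonneg M₂]
    rw [norm_mul, norm_div, Real.norm_of_nonneg (by positivity : 0 ≤ (1 + |s|) ^ (1 / 4 : ℝ))]
    gcongr
    · exact (div_le_iff₀ (abs_pos.2 hs0)).2 hquot
    · refine (Real.rpow_le_self_of_one_le (by linarith [abs_nonneg s]) (by norm_num)).trans ?_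
      linarith
  · have hwa : Integrable fun s => φ (a + s) * (1 + |a + s|) ^ (-(3 / 4) : ℝ) := hw.comp_add_left a
    refine ((((hwa.norm.const_mul ((1 + |a|) ^ (3 / 4 : ℝ))).add
      (integrable_unitStep l r).norm).const_mul (1 + 1 / δ)).integrableOn).mono' hmeas.restrict ?_
    filter_upwards [ae_restrict_mem measurableSet_Ioo.compl] with s hs
    have hsδ : δ ≤ |s| := by
      by_contra! h
      exact hs (abs_lt.1 h)
    have hs0 : 0 < |s| := hδ.trans_le hsδ
    -- Away from `0` the division by `s` lowers the exponent from `1/4` to `-3/4`, the weight under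
    -- which `φ` is integrable.
    have hq : (1 + |s|) ^ (1 / 4 : ℝ) / |s| ≤ (1 + 1 / δ) * (1 + |s|) ^ (-(3 / 4) : ℝ) := by
      have h1 : (1 + |s|) ^ (1 / 4 : ℝ) = (1 + |s|) ^ (-(3 / 4) : ℝ) * (1 + |s|) := by
        rw [← Real.rpow_add_one (by positivity)]; norm_num
      have h2 : 1 + |s| ≤ (1 + 1 / δ) * |s| := by
        have : 1 ≤ 1 / δ * |s| := by rw [one_div, ← div_eq_inv_mul]; exact (one_le_div hδ).2 hsδ
        linarith
      rw [h1, div_le_iff₀ hs0]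
      nlinarith [mul_le_mul_of_nonneg_left h2
        (by positivity : 0 ≤ (1 + |s|) ^ (-(3 / 4) : ℝ))]
    have hone : (1 + |s|) ^ (-(3 / 4) : ℝ) ≤ 1 :=
      Real.rpow_le_one_of_one_le_of_nonpos (by linarith) (by norm_num)
    have hshift : (1 + |s|) ^ (-(3 / 4) : ℝ) ≤
        (1 + |a|) ^ (3 / 4 : ℝ) * (1 + |a + s|) ^ (-(3 / 4) : ℝ) := by
      have h := one_add_abs_rpow_le (a + s) s (p := 3 / 4) (by norm_num)
      rw [add_sub_cancel_right] at h
      rw [Real.rpow_neg (by positivity), Real.rpow_neg (by positivity), ← div_eq_mul_inv,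
        le_div_iff₀ (by positivity), inv_mul_le_iff₀ (by positivity)]
      exact h
    have hp : 0 ≤ (1 + |s|) ^ (1 / 4 : ℝ) := by positivity
    rw [norm_mul, norm_div, Real.norm_of_nonneg hp, div_mul_eq_mul_div, mul_div_assoc]
    simp only [Pi.add_apply]
    have hp' : 0 ≤ (1 + |a + s|) ^ (-(3 / 4) : ℝ) := by positivity
    have hw0 : 0 ≤ (1 + |s|) ^ (-(3 / 4) : ℝ) := by positivity
    calc ‖φ (a + s) - unitStep l r s‖ * ((1 + |s|) ^ (1 / 4 : ℝ) / ‖s‖)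
        ≤ (‖φ (a + s)‖ + ‖unitStep l r s‖) * ((1 + 1 / δ) * (1 + |s|) ^ (-(3 / 4) : ℝ)) := by
          gcongr
          · exact norm_sub_le _ _
          · exact hq
      _ = (1 + 1 / δ) * (‖φ (a + s)‖ * (1 + |s|) ^ (-(3 / 4) : ℝ) +
            ‖unitStep l r s‖ * (1 + |s|) ^ (-(3 / 4) : ℝ)) := by ring
      _ ≤ (1 + 1 / δ) * (‖φ (a + s)‖ * ((1 + |a|) ^ (3 / 4 : ℝ) *
            (1 + |a + s|) ^ (-(3 / 4) : ℝ)) + ‖unitStep l r s‖ * 1) := by gcongr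
      _ = _ := by rw [norm_mul, Real.norm_of_nonneg hp']; ring

/-! ### Assembly. -/

theorem theorem3 (a : ℝ) (φ : ℝ → ℝ) (hφ : IsPiecewiseC1 φ)
    (hneg : IntegrableOn (fun x : ℝ => |x| ^ (-(3 / 4) : ℝ) * |φ x|) (Iic (-1)))
    (hpos : IntegrableOn (fun x : ℝ => x ^ (-(3 / 4) : ℝ) * |φ x|) (Ici 1)) :
    -- the inner integrals converge absolutely
    (∀ R x : ℝ, IntegrableOn (fun t : ℝ => airyAi (t - x) * airyAi (t - a)) (Ioi (-R))) ∧
    -- the outer integrals converge absolutely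
    (∀ R : ℝ, Integrable
      (fun x : ℝ => φ x * ∫ t in Ioi (-R), airyAi (t - x) * airyAi (t - a))) ∧
    -- the one-sided limits of `φ` at `a` exist, and the limit is their mean
    ∃ l r : ℝ, Tendsto φ (𝓝[<] a) (𝓝 l) ∧ Tendsto φ (𝓝[>] a) (𝓝 r) ∧
      Tendsto
        (fun R : ℝ => ∫ x : ℝ, φ x * ∫ t in Ioi (-R), airyAi (t - x) * airyAi (t - a))
        atTop (𝓝 ((1 / 2) * (l + r))) := by
  obtain ⟨l, -, hl, -⟩ := hφ.tendsto_left a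
  obtain ⟨r, -, hr, -⟩ := hφ.tendsto_right a
  have hh := integrable_sub_unitStep_div hφ (hφ.integrable_mul_weight hneg hpos) hl hr
  set h : ℝ → ℝ := fun s => (φ (a + s) - unitStep l r s) / s with hdef
  have hker : ∀ R s : ℝ, s ≠ 0 →
      ∫ t in Ioi (-R), airyAi (t - (a + s)) * airyAi (t - a) = airyKernel (R + a) s := by
    intro R s hs
    rw [airyKernel_of_ne _ hs, eq_div_iff hs, mul_comm]
    simpa using sub_mul_integral_airyAi_mul_airyAi R (a + s) a
  have hi₁ : ∀ b, Integrable ((Ioc (0 : ℝ) 1).indicator fun s => r * airyKernel b s) := fun b =>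
    (integrable_indicator_iff measurableSet_Ioc).2
      ((continuous_const.mul (continuous_airyKernel b)).integrableOn_Ioc)
  have hi₂ : ∀ b, Integrable ((Ioc (-1 : ℝ) 0).indicator fun s => l * airyKernel b s) := fun b =>
    (integrable_indicator_iff measurableSet_Ioc).2
      ((continuous_const.mul (continuous_airyKernel b)).integrableOn_Ioc)
  have hi₀ := integrable_mul_airyKernelNum hh
  -- This is `φ(a + s) = s h(s) + step`, multiplied by the kernel. It is asserted almost everywhere
  -- because `h` divides by zero at `s = 0`.
  have hdecomp : ∀ R : ℝ, (fun s => h s * airyKernelNum (R + a) s +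
      ((Ioc (0 : ℝ) 1).indicator (fun s => r * airyKernel (R + a) s) s +
        (Ioc (-1 : ℝ) 0).indicator (fun s => l * airyKernel (R + a) s) s)) =ᵐ[volume]
      fun s => φ (a + s) * ∫ t in Ioi (-R), airyAi (t - (a + s)) * airyAi (t - a) := by
    intro R
    filter_upwards [Measure.ae_ne volume (0 : ℝ)] with s hs
    rw [hker R s hs, indicator_mul_left, indicator_mul_left, ← add_mul]
    have : airyKernelNum (R + a) s = airyKernel (R + a) s * s := by
      rw [airyKernel_of_ne _ hs, div_mul_cancel₀ _ hs]
    rw [this, hdef]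
    simp only [unitStep, Pi.add_apply]
    field_simp
    ring
  have hsum : ∀ b, Integrable fun s => (Ioc (0 : ℝ) 1).indicator (fun s => r * airyKernel b s) s +
      (Ioc (-1 : ℝ) 0).indicator (fun s => l * airyKernel b s) s := fun b => (hi₁ b).add (hi₂ b)
  refine ⟨fun R x => integrableOn_airyAi_mul_airyAi R x a, fun R => ?_, l, r, hl, hr, ?_⟩
  · have := (((hi₀ (R + a)).add (hsum (R + a))).congr (hdecomp R)).comp_sub_right a
    simpa using this
  · have hval : ∀ R : ℝ, ∫ x : ℝ, φ x * ∫ t in Ioi (-R), airyAi (t - x) * airyAi (t - a) =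
        (∫ s, h s * airyKernelNum (R + a) s) +
          (r * (∫ s in (0 : ℝ)..1, airyKernel (R + a) (1 * s)) +
            l * ∫ s in (0 : ℝ)..1, airyKernel (R + a) (-1 * s)) := by
      intro R
      have hneg1 : ∫ s in Ioc (-1 : ℝ) 0, airyKernel (R + a) s =
          ∫ s in (0 : ℝ)..1, airyKernel (R + a) (-1 * s) := by
        simp_rw [neg_one_mul]
        rw [intervalIntegral.integral_comp_neg, neg_zero,
          intervalIntegral.integral_of_le (by norm_num)]
      rw [← integral_add_left_eq_self _ a, ← integral_congr_ae (hdecomp R),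
        integral_add (hi₀ _) (hsum _), integral_add (hi₁ _) (hi₂ _),
        integral_indicator measurableSet_Ioc, integral_indicator measurableSet_Ioc,
        integral_const_mul, integral_const_mul, hneg1,
        ← intervalIntegral.integral_of_le zero_le_one]
      simp_rw [one_mul]
      rfl
    have hb : Tendsto (fun R : ℝ => R + a) atTop atTop :=
      tendsto_atTop_add_const_right _ a tendsto_id
    have hlim := (tendsto_integral_mul_airyKernelNum hh).add
      (((tendsto_integral_airyKernel 1 (by simp)).const_mul r).add
        ((tendsto_integral_airyKernel (-1) (by simp)).const_mul l))
    rw [show 0 + (r * (1 / 2) + l * (1 / 2)) = 1 / 2 * (l + r) by ring] at hlim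
    exact (hlim.comp hb).congr fun R => (hval R).symm
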